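/- Let $\mathcal H,\mathcal K$ be finite dimensional complex Hilbert spaces, let $\mathcal A\subseteq B(\mathcal H)$ and $\mathcal B\subseteq B(\mathcal K)$ be unital $C^*$-subalgebras, and let $\mathrm{Tr}$ denote the traces of $B(\mathcal H)$ and $B(\mathcal K)$ restricted to them. A density operator is a positive element of trace one. For a linear map $T:\mathcal A\to\mathcal B$ let $T^*:\mathcal B\to\mathcal A$ be its adjoint for the Hilbert–Schmidt inner products $\langle a,b\rangle=\mathrm{Tr}\,a^*b$. A linear map $\Phi$ between such algebras is a unital Schwarz map if $\Phi(I)=I$ and $\Phi(a^*a)\ge\Phi(a)^*\Phi(a)$ for all $a$; its multiplicative domain is $\mathcal M_\Phi=\{a:\Phi(a^*a)=\Phi(a)^*\Phi(a),\ \Phi(aa^*)=\Phi(a)\Phi(a)^*\}$. For $\Phi:\mathcal A\to\mathcal A$ put $\mathcal F_\Phi=\{a\in\mathcal A:\Phi(a)=a\}$. For density operators with $\rho$ invertible let $d(\sigma,\rho)=\rho^{-1/2}\sigma\rho^{-1/2}$ (the commutant Radon–Nikodym derivative), and, for $\rho$ and $T(\rho)$ invertible, let $T_\rho:\mathcal A\to\mathcal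 B$, $T_\rho(b)=T(\rho)^{-1/2}T(\rho^{1/2}b\rho^{1/2})T(\rho)^{-1/2}$. Let $\mathcal S$ be a set of density operators in $\mathcal A$ and $T:\mathcal A\to\mathcal B$ a linear map. Suppose that $\mathcal S$ contains an invertible element $\rho$ such that $T(\rho)$ is invertible, and that $T^*$ and $T_\rho$ are unital Schwarz maps. Let $\Phi=T^*\circ T_\rho$. Then the following are equivalent. (i) $T$ is reversible for $\mathcal S$: there is a linear map $S:\mathcal B\to\mathcal A$ such that $S^*$ is a unital Schwarz map and $S(T(\sigma))=\sigma$ for all $\sigma\in\mathcal S$. (ii) $T^*(d(T(\sigma),T(\rho)))=d(\sigma,\rho)$ for all $\sigma\in\mathcal S$. (iii) $d(\sigma,\rho)\in\mathcal F_\Phi$ for all $\sigma\in\mathcal S$. (iv) $\rho^{it}d(\sigma,\rho)\rho^{-it}\in T^*(\mathcal M_{T^*})$ for all $\sigma\in\mathcal S$ and $t\in\mathbb R$. (v) There is a trace preserving completely positive map $\hat S:\mathcal B\to\mathcal A$ such that $\hat S(T(\sigma))=\sigma$ for all $\sigma\in\mathcal S$. (vi) There are trace preserving completely positive maps $\hat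 T:\mathcal A\to\mathcal B$ and $\hat S:\mathcal B\to\mathcal A$ such that $\hat T(\sigma)=T(\sigma)$ and $\hat S(T(\sigma))=\sigma$ for all $\sigma\in\mathcal S$. -/

import Mathlib

open scoped ComplexOrder InnerProductSpace

noncomputable section

namespace QRev

variable {H : Type*} [NormedAddCommGroup H] [InnerProductSpace ℂ H] [CompleteSpace H]
  [FiniteDimensional ℂ H]
variable {K : Type*} [NormedAddCommGroup K] [InnerProductSpace ℂ K] [CompleteSpace K]
  [FiniteDimensional ℂ K]

/-- A finite dimensional C*-algebra `𝒜 ⊆ B(H)` is a unital star subalgebra of `B(H)`.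
`tr a` is the trace of `B(H)`, restricted to `𝒜`. -/
def tr (A : StarSubalgebra ℂ (H →L[ℂ] H)) : A →ₗ[ℂ] ℂ where
  toFun a := LinearMap.trace ℂ H ((a : H →L[ℂ] H) : H →ₗ[ℂ] H)
  map_add' a b := by simp
  map_smul' c a := by simp

theorem trace_star_mul_self_eq_zero (a : H →L[ℂ] H)
    (h : LinearMap.trace ℂ H ((star a * a : H →L[ℂ] H) : H →ₗ[ℂ] H) = 0) : a = 0 := by
  let b := stdOrthonormalBasis ℂ H
  rw [LinearMap.trace_eq_sum_inner _ b] at h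
  have h1 : ∀ i, ⟪b i, ((star a * a : H →L[ℂ] H) : H →ₗ[ℂ] H) (b i)⟫_ℂ
      = ((‖a (b i)‖ ^ 2 : ℝ) : ℂ) := by
    intro i
    have : ⟪b i, (star a) (a (b i))⟫_ℂ = ⟪a (b i), a (b i)⟫_ℂ := by
      rw [ContinuousLinearMap.star_eq_adjoint, ContinuousLinearMap.adjoint_inner_right]
    simp only [ContinuousLinearMap.coe_coe, _root_.mul_apply_eq_comp]
    rw [this, inner_self_eq_norm_sq_to_K]
    simp
  simp only [h1] at h
  rw [← Complex.ofReal_sum] at h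
  have h2 : ∑ i, ‖a (b i)‖ ^ 2 = 0 := by exact_mod_cast h
  rw [Finset.sum_eq_zero_iff_of_nonneg (fun i _ => by positivity)] at h2
  have h3 : (a : H →ₗ[ℂ] H) = 0 := by
    apply b.toBasis.ext
    intro i
    have := h2 i (Finset.mem_univ i)
    simpa using this
  ext x
  exact LinearMap.congr_fun h3 x

instance finiteDimensional_op : FiniteDimensional ℂ (H →L[ℂ] H) :=
  LinearEquiv.finiteDimensional (LinearMap.toContinuousLinearMap (𝕜 := ℂ) (E := H) (F' := H))

instance finiteDimensional_sub (A : StarSubalgebra ℂ (H →L[ℂ] H)) : FiniteDimensional ℂ A :=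
  inferInstanceAs (FiniteDimensional ℂ (Subalgebra.toSubmodule A.toSubalgebra))

/-- The pairing `c ↦ (a ↦ Tr (c a))` of `𝒜` with its dual. -/
def traceForm (A : StarSubalgebra ℂ (H →L[ℂ] H)) : A →ₗ[ℂ] Module.Dual ℂ A :=
  (LinearMap.mul ℂ A).compr₂ (tr A)

theorem traceForm_injective (A : StarSubalgebra ℂ (H →L[ℂ] H)) :
    Function.Injective (traceForm A) := by
  rw [injective_iff_map_eq_zero]
  intro a ha
  have h : tr A (a * star a) = 0 := LinearMap.congr_fun ha (star a)
  have h2 := trace_star_mul_self_eq_zero (star (a : H →L[ℂ] H)) (by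
    rw [star_star]; exact h)
  exact Subtype.ext (star_eq_zero.mp h2)

/-- The trace pairing as a linear isomorphism of `𝒜` with its dual. -/
def traceDual (A : StarSubalgebra ℂ (H →L[ℂ] H)) : A ≃ₗ[ℂ] Module.Dual ℂ A :=
  LinearEquiv.ofInjectiveOfFinrankEq (traceForm A) (traceForm_injective A)
    (Subspace.dual_finrank_eq).symm

theorem traceDual_apply (A : StarSubalgebra ℂ (H →L[ℂ] H)) (c a : A) :
    traceDual A c a = tr A (c * a) := rfl

variable {A : StarSubalgebra ℂ (H →L[ℂ] H)} {B : StarSubalgebra ℂ (K →L[ℂ] K)}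

/-- The adjoint `T*` of a linear map `T : 𝒜 → ℬ` for the Hilbert-Schmidt inner products
`⟨a, b⟩ = Tr (a* b)`; it is characterized by `hsAdjoint_spec`. -/
def hsAdjoint (T : A →ₗ[ℂ] B) : B →ₗ[ℂ] A where
  toFun b := star ((traceDual A).symm (traceDual B (star b) ∘ₗ T))
  map_add' b c := by simp [LinearMap.add_comp]
  map_smul' z b := by simp [LinearMap.smul_comp]

theorem hsAdjoint_spec (T : A →ₗ[ℂ] B) (b : B) (a : A) :
    tr A (star (hsAdjoint T b) * a) = tr B (star b * T a) := by
  rw [← traceDual_apply]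
  simp [hsAdjoint, traceDual_apply]

theorem eq_hsAdjoint (T : A →ₗ[ℂ] B) (R : B →ₗ[ℂ] A)
    (h : ∀ b a, tr A (star (R b) * a) = tr B (star b * T a)) : R = hsAdjoint T := by
  ext1 b
  apply star_injective
  apply traceForm_injective A
  ext1 a
  exact (h b a).trans (hsAdjoint_spec T b a).symm

/-- The set of density operators of `𝒜`: positive elements of trace one. -/
def densities (A : StarSubalgebra ℂ (H →L[ℂ] H)) : Set A :=
  {a | 0 ≤ (a : H →L[ℂ] H) ∧ tr A a = 1}

theorem cfc_mem (f : ℂ → ℂ) (a : A) : cfc f (a : H →L[ℂ] H) ∈ A := by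
  have hA : IsClosed (A : Set (H →L[ℂ] H)) :=
    (Subalgebra.toSubmodule A.toSubalgebra).closed_of_finiteDimensional
  exact StarAlgebra.elemental.le_of_mem hA a.2 (cfc_mem_elemental f _)

/-- The power `a ^ s` (`s` complex) of a positive element `a`, by functional calculus. -/
def pow (a : A) (s : ℂ) : A :=
  ⟨cfc (fun z : ℂ => z ^ s) (a : H →L[ℂ] H), cfc_mem _ a⟩

/-- `Φ` is unital and satisfies the Schwarz inequality `Φ(a)* Φ(a) ≤ Φ(a* a)`. -/
def IsUnitalSchwarz (Φ : A →ₗ[ℂ] B) : Prop :=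
  Φ 1 = 1 ∧ ∀ a : A, ((star (Φ a) * Φ a : B) : K →L[ℂ] K) ≤ (Φ (star a * a) : K →L[ℂ] K)

/-- Positivity of a matrix `M ∈ M_n(𝒜)`, as an operator on `Hⁿ`. -/
def MatPos {n : ℕ} (M : Matrix (Fin n) (Fin n) A) : Prop :=
  ∀ x : Fin n → H, 0 ≤ ∑ i, ∑ j, ⟪x i, (M i j : H →L[ℂ] H) (x j)⟫_ℂ

/-- Complete positivity: `id ⊗ T : M_n(𝒜) → M_n(ℬ)` is positive for all `n`. -/
def IsCP (T : A →ₗ[ℂ] B) : Prop :=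
  ∀ (n : ℕ) (M : Matrix (Fin n) (Fin n) A), MatPos M → MatPos (M.map T)

/-- Completely positive and trace preserving. -/
def IsCPTP (T : A →ₗ[ℂ] B) : Prop :=
  IsCP T ∧ ∀ a, tr B (T a) = tr A a

/-- `T_ρ(b) = T(ρ)^{-1/2} T(ρ^{1/2} b ρ^{1/2}) T(ρ)^{-1/2}`, for invertible `ρ` and `T(ρ)`. -/
def petzDual (T : A →ₗ[ℂ] B) (ρ : A) : A →ₗ[ℂ] B where
  toFun b := pow (T ρ) (-1 / 2) * T (pow ρ (1 / 2) * b * pow ρ (1 / 2)) * pow (T ρ) (-1 / 2)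
  map_add' a b := by simp [mul_add, add_mul]
  map_smul' z b := by simp

/-- The commutant Radon-Nikodym derivative `d(σ, ρ) = ρ^{-1/2} σ ρ^{-1/2}`. -/
def rnDer (σ ρ : A) : A := pow ρ (-1 / 2) * σ * pow ρ (-1 / 2)

/-- The multiplicative domain `ℳ_Φ`. -/
def multDomain (Φ : A →ₗ[ℂ] B) : Set A :=
  {a | Φ (star a * a) = star (Φ a) * Φ a ∧ Φ (a * star a) = Φ a * star (Φ a)}

/-- The fixed points `ℱ_Φ`. -/
def fixedPts (Φ : A →ₗ[ℂ] A) : Set A := {a | Φ a = a}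

/-- `T` is reversible for `𝒮`: some `S : ℬ → 𝒜` whose adjoint is a unital Schwarz map recovers
every element of `𝒮`. -/
def Reversible (T : A →ₗ[ℂ] B) (𝒮 : Set A) : Prop :=
  ∃ S : B →ₗ[ℂ] A, IsUnitalSchwarz (hsAdjoint S) ∧ ∀ σ ∈ 𝒮, S (T σ) = σ

end QRev

end

set_option linter.unusedSectionVars false

noncomputable section

namespace QRev

/-! Everything rests on the fixed points of a composite `Φ = α ∘ β` of unital Schwarz maps that
carry two faithful states `Tr ρ·` and `Tr ρ'·` into each other (`IsInvariantPair`). A Schwarz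
inequality whose two sides have equal expectation in a faithful state is an equality. Hence the
fixed points form a star algebra, `Φ` is a bimodule map over it, `β` restricts to a star
homomorphism there, and the algebra is stable under `a ↦ ρ a ρ⁻¹`.

A recovery map `S` gives such a pair `(T*, S*)`. Since `S ∘ T` fixes `σ`, its adjoint fixes `σ ρ⁻¹`;
modular invariance moves this to the whole orbit of `d(σ, ρ)`, which lies in the image of the
multiplicative domain (`modular_orbit_mem_of_recovery`). Conversely, a subspace stable under the
modular group is spanned by modular eigenvectors, and on those lying in `T*(ℳ)` the map `T* ∘ T_ρ`
is the identity (`mem_fixedPts_of_modular_orbit`).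

Complete positivity comes from the fixed-point algebra: adjoints of star homomorphisms are
completely positive, and composing with the adjoint of the state-preserving conditional expectation
yields a channel that agrees with the desired map on `𝒮` (`exists_isCPTP_of_modular`). Used in both
directions of the pair `(T*, T_ρ)`, this produces both channels. -/

/-- The Jordan decomposition of a self-adjoint element of a C*-algebra. -/
theorem exists_sub_of_isSelfAdjoint {𝔐 : Type*} [NonUnitalCStarAlgebra 𝔐] (M : 𝔐)
    (hM : IsSelfAdjoint M) :
    ∃ d e : 𝔐, M = star d * d - star e * e ∧ (star d * d) * (star e * e) = 0 := by
  let _ := CStarAlgebra.spectralOrder 𝔐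
  have _ := CStarAlgebra.spectralOrderedRing 𝔐
  obtain ⟨d, hd⟩ := CStarAlgebra.nonneg_iff_eq_star_mul_self.mp (CFC.posPart_nonneg M)
  obtain ⟨e, he⟩ := CStarAlgebra.nonneg_iff_eq_star_mul_self.mp (CFC.negPart_nonneg M)
  refine ⟨d, e, ?_, ?_⟩
  · rw [← hd, ← he, CFC.posPart_sub_negPart M hM]
  · rw [← hd, ← he, CFC.posPart_mul_negPart M]

/-! ### Positive matrices over a C*-algebra, tested by a faithful functional. -/

section CStarMatrixPositivity

variable {𝔄 : Type*} [CStarAlgebra 𝔄] [PartialOrder 𝔄] [StarOrderedRing 𝔄] {ι : Type*} [Fintype ι]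
  [DecidableEq ι]

/-- A self-adjoint matrix over a C*-algebra that is positive for a faithful positive functional
is positive. -/
theorem exists_eq_star_mul_self_of_isSelfAdjoint_of_form_nonneg (τ : 𝔄 →ₗ[ℂ] ℂ)
    (hτ : ∀ a, 0 ≤ τ (star a * a)) (hτ0 : ∀ a, τ (star a * a) = 0 → a = 0)
    (M : CStarMatrix ι ι 𝔄) (hM : IsSelfAdjoint M)
    (h : ∀ y : ι → 𝔄, 0 ≤ ∑ i, ∑ j, τ (star (y i) * M i j * y j)) :
    ∃ d : CStarMatrix ι ι 𝔄, M = star d * d := by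
  obtain ⟨d, e, hMde, hde⟩ := exists_sub_of_isSelfAdjoint M hM
  refine ⟨d, ?_⟩
  set q := star e * e with he
  have hqs : star q = q := by rw [he, star_mul, star_star]
  -- Test the form on the columns of the negative part `q`: nonnegativity then forces the entries of
  -- `e * q` to vanish, by faithfulness of `τ`.
  have hMq : star q * (M * q) = - (star (e * q) * (e * q)) := by
    have h2 : M * q = - (q * q) := by rw [hMde, sub_mul, hde, zero_sub]
    rw [h2, hqs, mul_neg, star_mul, hqs, mul_assoc q, ← mul_assoc (star e), ← he]
  have hsum : ∑ k, ∑ l, τ (star ((e * q) l k) * (e * q) l k) ≤ 0 := by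
    have h3 : ∑ k, ∑ l, τ (star ((e * q) l k) * (e * q) l k)
        = - ∑ k, ∑ i, ∑ j, τ (star (q i k) * M i j * q j k) := by
      rw [← Finset.sum_neg_distrib]
      refine Finset.sum_congr rfl fun k _ => ?_
      have h4 := congrArg (fun X : CStarMatrix ι ι 𝔄 => τ (X k k)) hMq
      simp only [CStarMatrix.mul_apply, CStarMatrix.neg_apply, CStarMatrix.star_apply, map_sum,
        map_neg, Finset.mul_sum] at h4 ⊢
      rw [eq_neg_iff_add_eq_zero, add_comm, ← eq_neg_iff_add_eq_zero, ← h4]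
      simp [mul_assoc]
    rw [h3]
    exact neg_nonpos.mpr (Finset.sum_nonneg fun k _ => h fun i => q i k)
  have heq : e * q = 0 := by
    have h5 : ∑ k, ∑ l, τ (star ((e * q) l k) * (e * q) l k) = 0 :=
      le_antisymm hsum (Finset.sum_nonneg fun k _ => Finset.sum_nonneg fun l _ => hτ _)
    ext l k
    rw [Finset.sum_eq_zero_iff_of_nonneg
      (fun k _ => Finset.sum_nonneg fun l _ => hτ _)] at h5
    have h6 := h5 k (Finset.mem_univ k)
    rw [Finset.sum_eq_zero_iff_of_nonneg (fun l _ => hτ _)] at h6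
    exact hτ0 _ (h6 l (Finset.mem_univ l))
  have hqq : q * q = 0 := by
    nth_rw 1 [he]
    rw [mul_assoc, heq, mul_zero]
  have hq0 : q = 0 := by
    apply (CStarRing.star_mul_self_eq_zero_iff q).mp
    rw [hqs, hqq]
  rw [hMde, hq0, sub_zero]

/-- The form of `M` is real, so the self-adjoint matrix `i(M - M*)` has zero form; it and its
negative are then both squares, so it vanishes. -/
theorem isSelfAdjoint_of_form_nonneg (τ : 𝔄 →ₗ[ℂ] ℂ) (hτ : ∀ a, 0 ≤ τ (star a * a))
    (hτ0 : ∀ a, τ (star a * a) = 0 → a = 0) (hτs : ∀ a, τ (star a) = star (τ a))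
    (M : CStarMatrix ι ι 𝔄)
    (h : ∀ y : ι → 𝔄, 0 ≤ ∑ i, ∑ j, τ (star (y i) * M i j * y j)) : IsSelfAdjoint M := by
  set D : CStarMatrix ι ι 𝔄 := Complex.I • (M - star M) with hD
  have hDs : IsSelfAdjoint D := by
    rw [IsSelfAdjoint, hD, star_smul, star_sub, star_star, Complex.star_def, Complex.conj_I,
      neg_smul, ← smul_neg, neg_sub]
  have hform : ∀ y : ι → 𝔄, ∑ i, ∑ j, τ (star (y i) * D i j * y j) = 0 := by
    intro y
    have h1 : ∑ i, ∑ j, τ (star (y i) * (star M) i j * y j)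
        = star (∑ i, ∑ j, τ (star (y i) * M i j * y j)) := by
      rw [Finset.sum_comm, star_sum]
      refine Finset.sum_congr rfl fun i _ => ?_
      rw [star_sum]
      refine Finset.sum_congr rfl fun j _ => ?_
      rw [← hτs]
      simp [CStarMatrix.star_apply, mul_assoc]
    have h2 := (IsSelfAdjoint.of_nonneg (h y)).star_eq
    rw [h2] at h1
    simp only [hD, CStarMatrix.smul_apply, CStarMatrix.sub_apply, mul_smul_comm, smul_mul_assoc,
      map_smul, mul_sub, sub_mul, map_sub, Finset.sum_sub_distrib, smul_sub, ← Finset.smul_sum]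
    rw [h1, sub_self]
  have h1 := exists_eq_star_mul_self_of_isSelfAdjoint_of_form_nonneg τ hτ hτ0 D hDs
    (fun y => (hform y).ge)
  have h2 := exists_eq_star_mul_self_of_isSelfAdjoint_of_form_nonneg τ hτ hτ0 (-D) hDs.neg
    (fun y => by
    have := hform y
    simp only [CStarMatrix.neg_apply, mul_neg, neg_mul, map_neg, Finset.sum_neg_distrib]
    rw [this]; simp)
  obtain ⟨d, hd⟩ := h1
  obtain ⟨e, he⟩ := h2
  have h3 : D = 0 := by
    refine le_antisymm ?_ ?_
    · rw [← neg_nonneg, he]; exact star_mul_self_nonneg e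
    · rw [hd]; exact star_mul_self_nonneg d
  have h4 : M - star M = 0 := by
    rw [hD] at h3
    exact (smul_eq_zero.mp h3).resolve_left Complex.I_ne_zero
  exact (sub_eq_zero.mp h4).symm

end CStarMatrixPositivity

/-- A matrix over a C*-algebra that is positive for a faithful positive functional is positive. -/
theorem exists_eq_sum_star_mul_of_form_nonneg {𝔄 : Type*} [CStarAlgebra 𝔄] {n : ℕ}
    (τ : 𝔄 →ₗ[ℂ] ℂ) (hτ : ∀ a, 0 ≤ τ (star a * a))
    (hτ0 : ∀ a, τ (star a * a) = 0 → a = 0) (hτs : ∀ a, τ (star a) = star (τ a))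
    (M : Fin n → Fin n → 𝔄)
    (h : ∀ y : Fin n → 𝔄, 0 ≤ ∑ i, ∑ j, τ (star (y i) * M i j * y j)) :
    ∃ d : Fin n → Fin n → 𝔄, ∀ i j, M i j = ∑ k, star (d k i) * d k j := by
  let _ := CStarAlgebra.spectralOrder 𝔄
  have _ := CStarAlgebra.spectralOrderedRing 𝔄
  obtain ⟨d, hd⟩ := exists_eq_star_mul_self_of_isSelfAdjoint_of_form_nonneg τ hτ hτ0
    (CStarMatrix.ofMatrix (Matrix.of M)) (isSelfAdjoint_of_form_nonneg τ hτ hτ0 hτs _ h) h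
  refine ⟨d, fun i j => ?_⟩
  have := congrArg (fun X : CStarMatrix (Fin n) (Fin n) 𝔄 => X i j) hd
  simpa [CStarMatrix.mul_apply, CStarMatrix.star_apply] using this

variable {H : Type*} [NormedAddCommGroup H] [InnerProductSpace ℂ H] [CompleteSpace H]
  [FiniteDimensional ℂ H]
variable {K : Type*} [NormedAddCommGroup K] [InnerProductSpace ℂ K] [CompleteSpace K]
  [FiniteDimensional ℂ K]
variable {A : StarSubalgebra ℂ (H →L[ℂ] H)} {B : StarSubalgebra ℂ (K →L[ℂ] K)}

/-! ### Trace and positivity inside `A`. -/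

theorem tr_eq_sum_inner (a : A) :
    tr A a = ∑ i, ⟪stdOrthonormalBasis ℂ H i, (a : H →L[ℂ] H) (stdOrthonormalBasis ℂ H i)⟫_ℂ :=
  LinearMap.trace_eq_sum_inner _ _

theorem tr_mul_comm (a b : A) : tr A (a * b) = tr A (b * a) :=
  LinearMap.trace_mul_comm ℂ ((a : H →L[ℂ] H) : H →ₗ[ℂ] H) ((b : H →L[ℂ] H) : H →ₗ[ℂ] H)

theorem tr_star (a : A) : tr A (star a) = star (tr A a) := by
  simp only [tr_eq_sum_inner, star_sum]
  refine Finset.sum_congr rfl fun i _ => ?_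
  rw [StarMemClass.coe_star, ContinuousLinearMap.star_eq_adjoint,
    ContinuousLinearMap.adjoint_inner_right]
  exact (inner_conj_symm _ _).symm

theorem tr_star_mul_self_eq_zero (a : A) (h : tr A (star a * a) = 0) : a = 0 :=
  Subtype.ext (trace_star_mul_self_eq_zero (a : H →L[ℂ] H) h)

theorem eq_of_tr_mul (a b : A) (h : ∀ c, tr A (star c * a) = tr A (star c * b)) : a = b := by
  rw [← sub_eq_zero]
  apply tr_star_mul_self_eq_zero
  rw [mul_sub, map_sub, h, sub_self]

/-- Positive matrices over `A` give positive sesquilinear forms on `Aⁿ`. -/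
theorem MatPos.form_nonneg {n : ℕ} {M : Matrix (Fin n) (Fin n) A} (hM : MatPos M)
    (y : Fin n → A) : 0 ≤ ∑ i, ∑ j, tr A (star (y i) * M i j * y j) := by
  simp only [tr_eq_sum_inner]
  rw [Finset.sum_congr rfl fun i _ => Finset.sum_comm, Finset.sum_comm]
  refine Finset.sum_nonneg fun e _ => ?_
  refine (hM fun i => (y i : H →L[ℂ] H) (stdOrthonormalBasis ℂ H e)).trans_eq ?_
  refine Finset.sum_congr rfl fun i _ => Finset.sum_congr rfl fun j _ => ?_
  simp only [MulMemClass.coe_mul, StarMemClass.coe_star, mul_assoc,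
    ContinuousLinearMap.star_eq_adjoint, _root_.mul_apply_eq_comp,
    ContinuousLinearMap.adjoint_inner_right]

theorem matPos_of_eq_sum {n : ℕ} {M : Matrix (Fin n) (Fin n) A} {κ : Type*} [Fintype κ]
    (d : κ → Fin n → A) (h : ∀ i j, M i j = ∑ k, star (d k i) * d k j) : MatPos M := by
  intro x
  have h1 : ∑ i, ∑ j, ⟪x i, (M i j : H →L[ℂ] H) (x j)⟫_ℂ
      = ∑ k, ⟪∑ i, (d k i : H →L[ℂ] H) (x i), ∑ j, (d k j : H →L[ℂ] H) (x j)⟫_ℂ := by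
    simp only [h, AddSubmonoidClass.coe_finsetSum, sum_apply, inner_sum,
      sum_inner]
    rw [Finset.sum_congr rfl fun i _ => Finset.sum_comm, Finset.sum_comm]
    refine Finset.sum_congr rfl fun k _ => ?_
    rw [Finset.sum_comm]
    refine Finset.sum_congr rfl fun j _ => Finset.sum_congr rfl fun i _ => ?_
    simp only [MulMemClass.coe_mul, StarMemClass.coe_star,
      ContinuousLinearMap.star_eq_adjoint, _root_.mul_apply_eq_comp,
      ContinuousLinearMap.adjoint_inner_right]
  rw [h1]
  refine Finset.sum_nonneg fun k _ => ?_
  rw [inner_self_eq_norm_sq_to_K, ← RCLike.ofReal_pow]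
  exact RCLike.ofReal_nonneg.mpr (sq_nonneg _)

theorem tr_star_mul_self_nonneg (a : A) : 0 ≤ tr A (star a * a) := by
  have := MatPos.form_nonneg (M := fun _ _ : Fin 1 => (1 : A))
    (matPos_of_eq_sum (fun (_ : Fin 1) _ => (1 : A)) (by simp)) (fun _ => a)
  simpa using this

/-- A matrix over `A` is positive if it is positive as a form on `Aⁿ`. -/
theorem matPos_of_form_nonneg {n : ℕ} {M : Matrix (Fin n) (Fin n) A}
    (h : ∀ y : Fin n → A, 0 ≤ ∑ i, ∑ j, tr A (star (y i) * M i j * y j)) : MatPos M := by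
  -- Closedness supplies the C*-algebra instance on `A`.
  have : IsClosed (A : Set (H →L[ℂ] H)) :=
    (Subalgebra.toSubmodule A.toSubalgebra).closed_of_finiteDimensional
  obtain ⟨d, hd⟩ := exists_eq_sum_star_mul_of_form_nonneg (tr A) tr_star_mul_self_nonneg
    tr_star_mul_self_eq_zero tr_star M h
  exact matPos_of_eq_sum d hd

theorem matPos_one_iff (M : Matrix (Fin 1) (Fin 1) A) :
    MatPos M ↔ 0 ≤ (M 0 0 : H →L[ℂ] H) := by
  rw [ContinuousLinearMap.nonneg_iff_isPositive, ContinuousLinearMap.isPositive_iff_complex]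
  simp only [MatPos, Finset.univ_unique, Fin.default_eq_zero, Fin.isValue, Finset.sum_singleton]
  constructor
  · intro h x
    have h1 := h fun _ => x
    have h2 := (IsSelfAdjoint.of_nonneg h1).star_eq
    have h3 : ⟪(M 0 0 : H →L[ℂ] H) x, x⟫_ℂ = ⟪x, (M 0 0 : H →L[ℂ] H) x⟫_ℂ := by
      rw [← inner_conj_symm]; exact h2
    rw [h3]
    obtain ⟨h4, h5⟩ := Complex.nonneg_iff.mp h1
    exact ⟨Complex.ext (by simp) (by simpa using h5), h4⟩
  · intro h x
    obtain ⟨h1, h2⟩ := h (x 0)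
    rw [← inner_conj_symm, ← h1]
    simpa using h2

/-- An element of `A` is positive if it is positive on `A` in the trace pairing. -/
theorem nonneg_of_tr_nonneg (x : A) (h : ∀ y : A, 0 ≤ tr A (star y * x * y)) :
    0 ≤ (x : H →L[ℂ] H) := by
  have h1 : MatPos (fun _ _ : Fin 1 => x) := matPos_of_form_nonneg fun y => by simpa using h (y 0)
  exact (matPos_one_iff _).mp h1

theorem tr_nonneg_of_nonneg (x : A) (h : 0 ≤ (x : H →L[ℂ] H)) (y : A) :
    0 ≤ tr A (star y * x * y) := by
  simpa using MatPos.form_nonneg ((matPos_one_iff fun _ _ : Fin 1 => x).mpr h) fun _ => y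

theorem exists_eq_star_mul_self (x : A) (hx : 0 ≤ (x : H →L[ℂ] H)) : ∃ d : A, x = star d * d := by
  have : IsClosed (A : Set (H →L[ℂ] H)) :=
    (Subalgebra.toSubmodule A.toSubalgebra).closed_of_finiteDimensional
  obtain ⟨d, hd⟩ := exists_eq_sum_star_mul_of_form_nonneg (tr A) tr_star_mul_self_nonneg
    tr_star_mul_self_eq_zero tr_star (fun _ _ : Fin 1 => x)
    (fun y => by simpa using tr_nonneg_of_nonneg x hx (y 0))
  exact ⟨d 0 0, by simpa using hd 0 0⟩

theorem star_mul_self_coe_nonneg (a : A) : 0 ≤ ((star a * a : A) : H →L[ℂ] H) :=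
  star_mul_self_nonneg (a : H →L[ℂ] H)

theorem star_eq_of_nonneg (x : A) (hx : 0 ≤ (x : H →L[ℂ] H)) : star x = x :=
  Subtype.ext (IsSelfAdjoint.of_nonneg hx).star_eq

theorem tr_mul_nonneg (ρ x : A) (hρ : 0 ≤ (ρ : H →L[ℂ] H)) (hx : 0 ≤ (x : H →L[ℂ] H)) :
    0 ≤ tr A (ρ * x) := by
  obtain ⟨d, rfl⟩ := exists_eq_star_mul_self x hx
  rw [← mul_assoc, tr_mul_comm, ← mul_assoc]
  simpa using tr_nonneg_of_nonneg ρ hρ (star d)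

/-- With `x = d* d` and `ρ = e* e` the trace is the squared Hilbert–Schmidt norm of `d e*`, so `d ρ
= 0`. -/
theorem eq_zero_of_tr_mul_eq_zero (ρ x : A) (hρ : 0 ≤ (ρ : H →L[ℂ] H)) (hρu : IsUnit ρ)
    (hx : 0 ≤ (x : H →L[ℂ] H)) (h : tr A (ρ * x) = 0) : x = 0 := by
  obtain ⟨d, rfl⟩ := exists_eq_star_mul_self x hx
  obtain ⟨e, rfl⟩ := exists_eq_star_mul_self ρ hρ
  have h1 : d * star e = 0 := by
    apply tr_star_mul_self_eq_zero
    rw [star_mul, star_star, ← mul_assoc, tr_mul_comm, ← h]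
    simp only [mul_assoc]
  have h2 : d * (star e * e) = 0 := by rw [← mul_assoc, h1, zero_mul]
  rw [(hρu.mul_left_eq_zero).mp h2, mul_zero]

theorem map_star_of_nonneg {φ : A →ₗ[ℂ] B}
    (hφ : ∀ a : A, 0 ≤ (φ (star a * a) : K →L[ℂ] K)) (a : A) : φ (star a) = star (φ a) := by
  have key : ∀ x : A, star x = x → star (φ x) = φ x := by
    intro x hx
    -- Polarization against `1` writes a self-adjoint element as a real combination of squares.
    have h1 : x = (1 / 2 : ℂ) • (star (x + 1) * (x + 1) - star x * x - 1) := by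
      simp only [star_add, star_one, hx, add_mul, mul_add, mul_one, one_mul]
      rw [show x * x + x + (x + 1) - x * x - 1 = (2 : ℂ) • x by rw [two_smul]; abel, smul_smul]
      norm_num
    have h2 := star_eq_of_nonneg _ (hφ (x + 1))
    have h3 := star_eq_of_nonneg _ (hφ x)
    have h4 : star (φ 1) = φ 1 := by simpa using star_eq_of_nonneg _ (hφ 1)
    rw [h1]
    simp only [map_smul, map_sub, star_smul, star_sub, h2, h3, h4]
    congr 1
    simp
  have h1 := key (a + star a) (by rw [star_add, star_star, add_comm])
  have h2 := key (Complex.I • (a - star a)) (by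
    rw [star_smul, star_sub, star_star, Complex.star_def, Complex.conj_I, neg_smul, ← smul_neg,
      neg_sub])
  rw [map_add, star_add] at h1
  rw [map_smul, star_smul, map_sub, star_sub, Complex.star_def, Complex.conj_I, neg_smul,
    ← smul_neg] at h2
  have h3 := smul_right_injective B Complex.I_ne_zero h2
  have h4 : (2 : ℂ) • φ (star a) = (2 : ℂ) • star (φ a) := by
    rw [two_smul, two_smul]
    calc φ (star a) + φ (star a) = (φ a + φ (star a)) - (φ a - φ (star a)) := by abel
      _ = star (φ a) + star (φ a) := by rw [← h1, ← h3]; abel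
  exact smul_right_injective B two_ne_zero h4

/-! ### Unital Schwarz maps and their multiplicative domains. -/

namespace IsUnitalSchwarz

variable {φ : A →ₗ[ℂ] B} (hφ : IsUnitalSchwarz φ)
include hφ

theorem sub_nonneg (a : A) :
    0 ≤ ((φ (star a * a) - star (φ a) * φ a : B) : K →L[ℂ] K) := by
  simpa using _root_.sub_nonneg.mpr (hφ.2 a)

theorem map_nonneg (x : A) (hx : 0 ≤ (x : H →L[ℂ] H)) : 0 ≤ (φ x : K →L[ℂ] K) := by
  obtain ⟨d, rfl⟩ := exists_eq_star_mul_self x hx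
  exact (star_mul_self_coe_nonneg (φ d)).trans (hφ.2 d)

theorem map_star (a : A) : φ (star a) = star (φ a) :=
  map_star_of_nonneg (fun a => hφ.map_nonneg _ (star_mul_self_coe_nonneg a)) a

/-- The Schwarz defect is a positive sesquilinear form that vanishes at `a`. Along `z • a + c` it
has no quadratic term in `z`, so nonnegativity forces the cross term to vanish. -/
theorem map_mul_of_eq (a : A) (ha : φ (star a * a) = star (φ a) * φ a) (c : A) :
    φ (c * a) = φ c * φ a := by
  rw [← star_star c]
  generalize star c = c
  have key : ∀ y : B, tr B (star y * (φ (star c * a) - star (φ c) * φ a) * y) = 0 := by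
    intro y
    set w := tr B (star y * (φ (star c * a) - star (φ c) * φ a) * y) with hw
    set k := tr B (star y * (φ (star c * c) - star (φ c) * φ c) * y) with hk
    have hw' : tr B (star y * (φ (star a * c) - star (φ a) * φ c) * y) = star w := by
      rw [hw, ← tr_star]
      simp only [star_mul, star_sub, star_star, ← hφ.map_star, mul_assoc]
    have hz : ∀ z : ℂ, 0 ≤ star z * star w + z * w + k := by
      intro z
      have h1 := tr_nonneg_of_nonneg _ (hφ.sub_nonneg (z • a + c)) y
      have h2 : φ (star (z • a + c) * (z • a + c)) - star (φ (z • a + c)) * φ (z • a + c)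
          = star z • (φ (star a * c) - star (φ a) * φ c)
            + z • (φ (star c * a) - star (φ c) * φ a)
            + (φ (star c * c) - star (φ c) * φ c) := by
        simp only [star_add, star_smul, add_mul, mul_add, map_add, map_smul, smul_mul_assoc,
          mul_smul_comm, ha]
        module
      rw [h2] at h1
      simpa only [mul_add, add_mul, map_add, mul_smul_comm, smul_mul_assoc, map_smul, hw', ← hw,
        ← hk, smul_eq_mul] using h1
    by_contra hw0
    have hn : 0 < Complex.normSq w := Complex.normSq_pos.mpr hw0
    -- This `z` makes `z * w = -(k.re + 1)`, so the real part becomes `-k.re - 2`; `z = 0` gives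
    -- `k.re ≥ 0`.
    have h3 := (Complex.nonneg_iff.mp (hz (-((k.re + 1) / Complex.normSq w : ℝ) * star w))).1
    have h4 : (-((k.re + 1) / Complex.normSq w : ℝ) * star w) * w = ((-(k.re + 1) : ℝ) : ℂ) := by
      rw [mul_assoc, Complex.star_def, ← Complex.normSq_eq_conj_mul_self]
      push_cast
      field_simp
    have h5 : star (-((k.re + 1) / Complex.normSq w : ℝ) * star w) * star w
        = ((-(k.re + 1) : ℝ) : ℂ) := by
      rw [mul_comm, ← star_mul, h4, Complex.star_def, Complex.conj_ofReal]
    rw [h4, h5] at h3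
    have h6 := (Complex.nonneg_iff.mp (hz 0)).1
    simp at h3 h6
    linarith
  have h1 := nonneg_of_tr_nonneg _ fun y => (key y).ge
  have h2 := nonneg_of_tr_nonneg (-(φ (star c * a) - star (φ c) * φ a)) fun y => by
    rw [mul_neg, neg_mul, map_neg, key, neg_zero]
  rw [NegMemClass.coe_neg, neg_nonneg] at h2
  have h3 : φ (star c * a) - star (φ c) * φ a = 0 := Subtype.ext (le_antisymm h2 h1)
  rw [hφ.map_star]
  exact sub_eq_zero.mp h3

theorem mul_map_of_eq (a : A) (ha : φ (a * star a) = φ a * star (φ a)) (c : A) :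
    φ (a * c) = φ a * φ c := by
  have h := hφ.map_mul_of_eq (star a) (by rw [star_star, hφ.map_star, star_star, ha]) (star c)
  apply star_injective
  rw [star_mul, ← hφ.map_star, ← hφ.map_star, ← hφ.map_star, star_mul, h]

end IsUnitalSchwarz

theorem IsUnitalSchwarz.comp {L : Type*} [NormedAddCommGroup L] [InnerProductSpace ℂ L]
    [CompleteSpace L] [FiniteDimensional ℂ L] {C : StarSubalgebra ℂ (L →L[ℂ] L)}
    {ψ : B →ₗ[ℂ] C} {φ : A →ₗ[ℂ] B} (hψ : IsUnitalSchwarz ψ) (hφ : IsUnitalSchwarz φ) :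
    IsUnitalSchwarz (ψ ∘ₗ φ) := by
  refine ⟨by simp [hφ.1, hψ.1], fun a => (hψ.2 (φ a)).trans ?_⟩
  have := hψ.map_nonneg _ (hφ.sub_nonneg a)
  simpa using this

/-! ### Invariant pairs and the algebra of fixed points. -/

/-- Two unital Schwarz maps that intertwine two faithful positive functionals. -/
structure IsInvariantPair (ρ : A) (ρ' : B) (α : B →ₗ[ℂ] A) (β : A →ₗ[ℂ] B) : Prop where
  nonneg : 0 ≤ (ρ : H →L[ℂ] H)
  isUnit : IsUnit ρ
  nonneg' : 0 ≤ (ρ' : K →L[ℂ] K)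
  isUnit' : IsUnit ρ'
  schwarz : IsUnitalSchwarz α
  schwarz' : IsUnitalSchwarz β
  tr_map : ∀ b, tr A (ρ * α b) = tr B (ρ' * b)
  tr_map' : ∀ a, tr B (ρ' * β a) = tr A (ρ * a)

namespace IsInvariantPair

variable {ρ : A} {ρ' : B} {α : B →ₗ[ℂ] A} {β : A →ₗ[ℂ] B} (h : IsInvariantPair ρ ρ' α β)
include h

theorem symm : IsInvariantPair ρ' ρ β α :=
  ⟨h.nonneg', h.isUnit', h.nonneg, h.isUnit, h.schwarz', h.schwarz, h.tr_map', h.tr_map⟩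

theorem schwarz_comp : IsUnitalSchwarz (α ∘ₗ β) := h.schwarz.comp h.schwarz'

theorem tr_comp (a : A) : tr A (ρ * (α ∘ₗ β) a) = tr A (ρ * a) := by
  simp [h.tr_map, h.tr_map']

theorem eq_of_le {x y : A} (hxy : 0 ≤ ((x - y : A) : H →L[ℂ] H))
    (ht : tr A (ρ * x) = tr A (ρ * y)) : x = y := by
  apply sub_eq_zero.mp
  exact eq_zero_of_tr_mul_eq_zero ρ _ h.nonneg h.isUnit hxy (by rw [mul_sub, map_sub, ht, sub_self])

theorem star_mem {a : A} (ha : a ∈ fixedPts (α ∘ₗ β)) : star a ∈ fixedPts (α ∘ₗ β) := by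
  rw [fixedPts, Set.mem_ofPred_eq, h.schwarz_comp.map_star, ha]

/-- The Schwarz inequality reads `a* a ≤ Φ(a* a)`, and both sides have the same expectation in `ρ`.
-/
theorem star_mul_self_mem {a : A} (ha : a ∈ fixedPts (α ∘ₗ β)) :
    star a * a ∈ fixedPts (α ∘ₗ β) := by
  refine h.eq_of_le ?_ (h.tr_comp _)
  have := h.schwarz_comp.sub_nonneg a
  rwa [show (α ∘ₗ β) a = a from ha] at this

theorem map_mul_right {a : A} (ha : a ∈ fixedPts (α ∘ₗ β)) (c : A) :
    (α ∘ₗ β) (c * a) = (α ∘ₗ β) c * a := by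
  have ha' : (α ∘ₗ β) a = a := ha
  rw [h.schwarz_comp.map_mul_of_eq a (by rw [ha']; exact h.star_mul_self_mem ha) c, ha']

theorem map_mul_left {a : A} (ha : a ∈ fixedPts (α ∘ₗ β)) (c : A) :
    (α ∘ₗ β) (a * c) = a * (α ∘ₗ β) c := by
  apply star_injective
  rw [← h.schwarz_comp.map_star, star_mul, h.map_mul_right (h.star_mem ha), star_mul,
    h.schwarz_comp.map_star]

theorem mul_mem {a b : A} (ha : a ∈ fixedPts (α ∘ₗ β)) (hb : b ∈ fixedPts (α ∘ₗ β)) :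
    a * b ∈ fixedPts (α ∘ₗ β) := by
  rw [fixedPts, Set.mem_ofPred_eq, h.map_mul_left ha, hb]

/-- The fixed points are those of the adjoint map, multiplied by `ρ`. -/
theorem mem_fixedPts_of_tr {a : A}
    (ha : ∀ c, tr A ((α ∘ₗ β) c * (a * ρ)) = tr A (c * (a * ρ))) : a ∈ fixedPts (α ∘ₗ β) := by
  set Φ := α ∘ₗ β
  have e1 : tr A (ρ * (star (Φ a) * a)) = tr A (ρ * (star a * a)) := by
    have := ha (star a)
    rw [h.schwarz_comp.map_star, ← mul_assoc, ← mul_assoc, tr_mul_comm, tr_mul_comm _ ρ] at this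
    exact this
  have hρs := star_eq_of_nonneg ρ h.nonneg
  have e2 : tr A (ρ * (star a * Φ a)) = tr A (ρ * (star a * a)) := by
    have h1 := congrArg star e1
    rw [← tr_star, ← tr_star] at h1
    simp only [star_mul, star_star, hρs] at h1
    rw [tr_mul_comm, tr_mul_comm _ ρ] at h1
    exact h1
  -- The expected Schwarz defect and the expectation of `|Φ(a) - a|²` are both nonnegative; once
  -- they sum to zero, faithfulness gives `Φ(a) = a`.
  have e3 : tr A (ρ * (Φ (star a * a) - star (Φ a) * Φ a)) + tr A (ρ * (star (Φ a - a) * (Φ a - a)))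
      = 0 := by
    simp only [star_sub, sub_mul, mul_sub, map_sub, e1, e2]
    rw [show tr A (ρ * Φ (star a * a)) = _ from h.tr_comp _]
    ring
  have p1 := tr_mul_nonneg ρ _ h.nonneg (h.schwarz_comp.sub_nonneg a)
  have p2 := tr_mul_nonneg ρ _ h.nonneg (star_mul_self_coe_nonneg (Φ a - a))
  have e4 : tr A (ρ * (star (Φ a - a) * (Φ a - a))) = 0 :=
    le_antisymm (by rw [← e3]; exact le_add_of_nonneg_left p1) p2
  have e5 := eq_zero_of_tr_mul_eq_zero ρ _ h.nonneg h.isUnit (star_mul_self_coe_nonneg _) e4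
  have e6 := tr_star_mul_self_eq_zero (Φ a - a) (by rw [e5, map_zero])
  exact sub_eq_zero.mp e6

/-- The fixed points are invariant under the modular group. -/
theorem modular_mem {a b : A} (ha : a ∈ fixedPts (α ∘ₗ β)) (hb : b * ρ = ρ * a) :
    b ∈ fixedPts (α ∘ₗ β) := by
  refine h.mem_fixedPts_of_tr fun c => ?_
  -- By cyclicity the claim is `Tr ρ a Φ(c) = Tr ρ a c`; the bimodule property moves `a` inside `Φ`,
  -- and `ρ` is invariant.
  rw [hb, ← mul_assoc, ← mul_assoc, tr_mul_comm, tr_mul_comm (c * ρ), ← mul_assoc, ← mul_assoc,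
    ← h.map_mul_left ha, tr_mul_comm, tr_mul_comm _ ρ, h.tr_comp]

/-- The chain `a* a = α(β(a* a)) ≥ α(β(a)* β(a)) ≥ α(β(a))* α(β(a)) = a* a` collapses, so the
Schwarz defect of `β` at `a` has expectation zero in `ρ'`. -/
theorem map_star_mul_self {a : A} (ha : a ∈ fixedPts (α ∘ₗ β)) :
    β (star a * a) = star (β a) * β a := by
  refine h.symm.eq_of_le (h.schwarz'.sub_nonneg a) ?_
  rw [← h.tr_map, ← h.tr_map]
  have h1 : α (β (star a * a)) = star a * a := h.star_mul_self_mem ha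
  have h2 : α (β a) = a := ha
  have h3 := h.schwarz.sub_nonneg (β a)
  have h4 := h.schwarz.map_nonneg _ (h.schwarz'.sub_nonneg a)
  rw [map_sub, h1] at h4
  rw [h2] at h3
  rw [h1]
  congr 2
  simp only [AddSubgroupClass.coe_sub, _root_.sub_nonneg] at h3 h4
  exact Subtype.ext (le_antisymm h3 h4)

theorem map_mul_of_mem {a : A} (ha : a ∈ fixedPts (α ∘ₗ β)) (c : A) :
    β (c * a) = β c * β a :=
  h.schwarz'.map_mul_of_eq a (h.map_star_mul_self ha) c

theorem map_mem_multDomain {a : A} (ha : a ∈ fixedPts (α ∘ₗ β)) : β a ∈ multDomain α := by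
  have key : ∀ {a : A}, a ∈ fixedPts (α ∘ₗ β) →
      α (star (β a) * β a) = star (α (β a)) * α (β a) := by
    intro a ha
    rw [← h.map_star_mul_self ha, show α (β a) = a from ha]
    exact h.star_mul_self_mem ha
  refine ⟨key ha, ?_⟩
  have := key (h.star_mem ha)
  simpa only [h.schwarz'.map_star, h.schwarz.map_star, star_star] using this

end IsInvariantPair

/-! ### Spectral projections, complex powers and modular eigenvectors. -/

/-- Every function is continuous on a finite set, so the functional calculus applies to indicators
and complex powers alike. -/
theorem finite_spectrum (a : H →L[ℂ] H) : (spectrum ℂ a).Finite := by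
  let e : (H →L[ℂ] H) ≃ₐ[ℂ] Module.End ℂ H :=
    AlgEquiv.ofLinearEquiv LinearMap.toContinuousLinearMap.symm rfl fun _ _ => rfl
  rw [← AlgEquiv.spectrum_eq e a]
  exact Module.End.finite_spectrum _

/-- The functional calculus in `A`. -/
def funCalc (a : A) (f : ℂ → ℂ) : A := ⟨cfc f (a : H →L[ℂ] H), cfc_mem f a⟩

/-- The spectrum of an element of `A`, as a finite set. -/
def spec (a : A) : Finset ℂ := (finite_spectrum (a : H →L[ℂ] H)).toFinset

theorem mem_spec {a : A} {r : ℂ} : r ∈ spec a ↔ r ∈ spectrum ℂ (a : H →L[ℂ] H) := by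
  simp [spec]

theorem funCalc_mul (a : A) (f g : ℂ → ℂ) :
    funCalc a f * funCalc a g = funCalc a fun z => f z * g z :=
  Subtype.ext (cfc_mul f g (a : H →L[ℂ] H) ((finite_spectrum _).continuousOn _)
    ((finite_spectrum _).continuousOn _)).symm

theorem funCalc_congr (a : A) {f g : ℂ → ℂ} (h : ∀ r ∈ spec a, f r = g r) :
    funCalc a f = funCalc a g :=
  Subtype.ext (cfc_congr fun r hr => h r (mem_spec.mpr hr))

/-- The spectral projections of `a`. -/
def specProj (a : A) (r : ℂ) : A := funCalc a fun z => if z = r then 1 else 0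

section

variable {ρ : A} (hρ : 0 ≤ (ρ : H →L[ℂ] H))
include hρ

theorem funCalc_id : funCalc ρ (fun z => z) = ρ := by
  have : IsStarNormal (ρ : H →L[ℂ] H) := (IsSelfAdjoint.of_nonneg hρ).isStarNormal
  exact Subtype.ext (cfc_id' ℂ (ρ : H →L[ℂ] H))

theorem funCalc_one : funCalc ρ (fun _ => 1) = 1 := by
  have : IsStarNormal (ρ : H →L[ℂ] H) := (IsSelfAdjoint.of_nonneg hρ).isStarNormal
  exact Subtype.ext (cfc_const_one ℂ (ρ : H →L[ℂ] H))

theorem sum_specProj : ∑ r ∈ spec ρ, specProj ρ r = 1 := by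
  have h1 : ∑ r ∈ spec ρ, specProj ρ r
      = funCalc ρ (∑ r ∈ spec ρ, fun z => if z = r then 1 else 0) := by
    apply Subtype.ext
    rw [AddSubmonoidClass.coe_finsetSum]
    exact (cfc_sum _ _ _ fun _ _ => (finite_spectrum _).continuousOn _).symm
  rw [h1, ← funCalc_one hρ]
  refine funCalc_congr ρ fun r hr => ?_
  simp [Finset.sum_apply, hr]

theorem eq_sum_specProj (x : A) :
    x = ∑ r ∈ spec ρ, ∑ s ∈ spec ρ, specProj ρ r * x * specProj ρ s := by
  simp only [← Finset.mul_sum, sum_specProj hρ, mul_one, ← Finset.sum_mul, one_mul]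

theorem eq_of_specProj {x y : A} (h : ∀ r ∈ spec ρ, ∀ s ∈ spec ρ,
    specProj ρ r * x * specProj ρ s = specProj ρ r * y * specProj ρ s) : x = y := by
  rw [eq_sum_specProj hρ x, eq_sum_specProj hρ y]
  exact Finset.sum_congr rfl fun r hr => Finset.sum_congr rfl fun s hs => h r hr s hs

omit hρ in
theorem specProj_mul_funCalc (r : ℂ) (f : ℂ → ℂ) :
    specProj ρ r * funCalc ρ f = f r • specProj ρ r := by
  have h1 : f r • specProj ρ r = funCalc ρ fun z => f r • if z = r then 1 else 0 :=
    Subtype.ext (cfc_smul (f r) _ _ ((finite_spectrum _).continuousOn _)).symm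
  rw [h1, specProj, funCalc_mul]
  refine funCalc_congr ρ fun s _ => ?_
  by_cases h : s = r <;> simp [h]

omit hρ in
theorem funCalc_mul_specProj (r : ℂ) (f : ℂ → ℂ) :
    funCalc ρ f * specProj ρ r = f r • specProj ρ r := by
  rw [← specProj_mul_funCalc, specProj, funCalc_mul, funCalc_mul]
  exact funCalc_congr ρ fun s _ => mul_comm _ _

theorem specProj_mul_self (r : ℂ) : specProj ρ r * ρ = r • specProj ρ r := by
  have := specProj_mul_funCalc (ρ := ρ) r fun z => z
  rwa [funCalc_id hρ] at this

theorem self_mul_specProj (r : ℂ) : ρ * specProj ρ r = r • specProj ρ r := by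
  have := funCalc_mul_specProj (ρ := ρ) r fun z => z
  rwa [funCalc_id hρ] at this

variable (hu : IsUnit ρ)
include hu

theorem exists_pos_of_mem_spec {r : ℂ} (hr : r ∈ spec ρ) : ∃ x : ℝ, 0 < x ∧ r = x := by
  rw [mem_spec] at hr
  have h0 : (0 : ℂ) ≤ r := spectrum_nonneg_of_nonneg hρ hr
  have h1 : r ≠ 0 := by
    rintro rfl
    exact spectrum.zero_notMem ℂ (hu.map A.subtype) hr
  obtain ⟨h2, h3⟩ := Complex.nonneg_iff.mp h0
  have h4 : r = r.re := Complex.ext (by simp) (by simpa using h3.symm)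
  refine ⟨r.re, lt_of_le_of_ne h2 fun h => h1 ?_, h4⟩
  rw [h4, ← h]; simp

theorem ne_zero_of_mem_spec {r : ℂ} (hr : r ∈ spec ρ) : r ≠ 0 := by
  obtain ⟨x, hx, rfl⟩ := exists_pos_of_mem_spec hρ hu hr
  exact_mod_cast hx.ne'

theorem pow_mul_pow (z w : ℂ) : pow ρ z * pow ρ w = pow ρ (z + w) :=
  (funCalc_mul ρ _ _).trans (funCalc_congr ρ fun _ hr =>
    (Complex.cpow_add _ _ (ne_zero_of_mem_spec hρ hu hr)).symm)

omit hu in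
theorem pow_one' : pow ρ 1 = ρ :=
  (funCalc_congr ρ fun _ _ => Complex.cpow_one _).trans (funCalc_id hρ)

omit hu in
theorem pow_zero' : pow ρ 0 = 1 :=
  (funCalc_congr ρ fun _ _ => Complex.cpow_zero _).trans (funCalc_one hρ)

theorem pow_half_mul_pow_half : pow ρ (1 / 2) * pow ρ (1 / 2) = ρ := by
  rw [pow_mul_pow hρ hu]; norm_num [pow_one' hρ]

theorem pow_mul_pow_neg (z : ℂ) : pow ρ z * pow ρ (-z) = 1 := by
  rw [pow_mul_pow hρ hu, add_neg_cancel, pow_zero' hρ]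

theorem pow_neg_mul_pow (z : ℂ) : pow ρ (-z) * pow ρ z = 1 := by
  rw [pow_mul_pow hρ hu, neg_add_cancel, pow_zero' hρ]

theorem pow_half_mul_pow_neg_half : pow ρ (1 / 2) * pow ρ (-1 / 2) = 1 := by
  rw [neg_div]; exact pow_mul_pow_neg hρ hu _

theorem pow_neg_half_mul_pow_half : pow ρ (-1 / 2) * pow ρ (1 / 2) = 1 := by
  rw [neg_div]; exact pow_neg_mul_pow hρ hu _

theorem pow_neg_half_mul_self_mul_pow_neg_half :
    pow ρ (-1 / 2) * ρ * pow ρ (-1 / 2) = 1 := by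
  have : pow ρ (-1 / 2) * pow ρ 1 * pow ρ (-1 / 2) = 1 := by
    rw [pow_mul_pow hρ hu, pow_mul_pow hρ hu]; norm_num [pow_zero' hρ]
  rwa [pow_one' hρ] at this

theorem star_pow (s : ℝ) : star (pow ρ s) = pow ρ s := by
  have h1 : star (pow ρ s) = funCalc ρ fun z => star (z ^ (s : ℂ)) :=
    Subtype.ext (cfc_star _ _).symm
  rw [h1]
  refine funCalc_congr ρ fun r hr => ?_
  obtain ⟨x, hx, rfl⟩ := exists_pos_of_mem_spec hρ hu hr
  rw [← Complex.ofReal_cpow hx.le, Complex.star_def, Complex.conj_ofReal]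

theorem star_pow_half : star (pow ρ (1 / 2)) = pow ρ (1 / 2) := by
  have := star_pow hρ hu (1 / 2)
  push_cast at this; exact this

theorem star_pow_neg_half : star (pow ρ (-1 / 2)) = pow ρ (-1 / 2) := by
  have := star_pow hρ hu (-1 / 2)
  push_cast at this; exact this

/-- An eigenvector of `x ↦ ρ x ρ⁻¹` is an eigenvector of the modular group of `ρ`. -/
theorem pow_mul_of_eigen {x : A} {l : ℝ} (hl : 0 < l) (hx : ρ * x = (l : ℂ) • (x * ρ)) (z : ℂ) :
    pow ρ z * x = (l : ℂ) ^ z • (x * pow ρ z) := by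
  refine eq_of_specProj hρ fun r hr s hs => ?_
  have e1 : specProj ρ r * (pow ρ z * x) * specProj ρ s
      = r ^ z • (specProj ρ r * x * specProj ρ s) := by
    rw [← mul_assoc, pow, ← funCalc, specProj_mul_funCalc, smul_mul_assoc, smul_mul_assoc]
  have e2 : specProj ρ r * ((l : ℂ) ^ z • (x * pow ρ z)) * specProj ρ s
      = ((l : ℂ) ^ z * s ^ z) • (specProj ρ r * x * specProj ρ s) := by
    rw [mul_smul_comm, smul_mul_assoc, mul_smul, mul_assoc, mul_assoc x, pow, ← funCalc,
      funCalc_mul_specProj, mul_smul_comm, mul_smul_comm, mul_assoc]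
  have e3 : r • (specProj ρ r * x * specProj ρ s)
      = ((l : ℂ) * s) • (specProj ρ r * x * specProj ρ s) := by
    have := congrArg (fun y => specProj ρ r * y * specProj ρ s) hx
    simpa only [← mul_assoc, specProj_mul_self hρ, smul_mul_assoc, mul_smul_comm, mul_smul,
      mul_assoc _ ρ, self_mul_specProj hρ] using this
  rw [e1, e2]
  -- On a nonzero block the eigenvector equation says `r = l * s`, and powers of positive reals
  -- multiply.
  by_cases h0 : specProj ρ r * x * specProj ρ s = 0
  · rw [h0, smul_zero, smul_zero]
  · rw [smul_left_injective ℂ h0 e3]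
    obtain ⟨y, hy, rfl⟩ := exists_pos_of_mem_spec hρ hu hs
    rw [Complex.mul_cpow_ofReal_nonneg hl.le hy.le]

/-- The elements of `W` that are eigenvectors of `x ↦ ρ x ρ⁻¹`. -/
def eigenIn (ρ : A) (W : Submodule ℂ A) : Set A :=
  {y | y ∈ W ∧ ∃ l : ℝ, 0 < l ∧ ρ * y = (l : ℂ) • (y * ρ)}

/-- Conjugation by `ρ ^ z` is diagonalizable: it scales the block between the projections of `r` and
`s` by `r ^ z * s ^ (-z)`. An invariant subspace is therefore the sum of its intersections with the
eigenspaces. By `hz` the eigenvalue determines the ratio `r / s`, so these vectors are eigenvectors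
for `ρ` itself. -/
theorem le_span_eigenIn (W : Submodule ℂ A) (z : ℂ)
    (hz : ∀ r ∈ spec ρ, ∀ s ∈ spec ρ, ∀ r' ∈ spec ρ, ∀ s' ∈ spec ρ,
      r ^ z * s ^ (-z) = r' ^ z * s' ^ (-z) → r * s' = r' * s)
    (hW : ∀ x ∈ W, pow ρ z * x * pow ρ (-z) ∈ W) : W ≤ Submodule.span ℂ (eigenIn ρ W) := by
  let U : Module.End ℂ A := LinearMap.mulRight ℂ (pow ρ (-z)) ∘ₗ LinearMap.mulLeft ℂ (pow ρ z)
  have hU : ∀ x, U x = pow ρ z * x * pow ρ (-z) := fun _ => rfl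
  have htop : ⨆ μ, U.genEigenspace μ 1 = ⊤ := by
    rw [eq_top_iff]
    intro x _
    rw [eq_sum_specProj hρ x]
    refine Submodule.sum_mem _ fun r _ => Submodule.sum_mem _ fun s _ => ?_
    refine Submodule.mem_iSup_of_mem (r ^ z * s ^ (-z)) ?_
    refine Module.End.mem_eigenspace_iff.mpr ?_
    rw [hU]
    rw [← mul_assoc, ← mul_assoc, pow, ← funCalc, funCalc_mul_specProj, pow, ← funCalc, mul_assoc,
      specProj_mul_funCalc]
    simp only [smul_mul_assoc, mul_smul_comm]
    rw [smul_comm, mul_smul]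
  rw [Submodule.eq_iSup_inf_genEigenspace 1 hW htop]
  conv_rhs => rw [← Submodule.eq_iSup_inf_genEigenspace 1 hW htop]
  refine iSup_le fun μ y hy => Submodule.subset_span ⟨hy.1, ?_⟩
  have hyμ : U y = μ • y := Module.End.mem_eigenspace_iff.mp hy.2
  have hc : ∀ r ∈ spec ρ, ∀ s ∈ spec ρ, specProj ρ r * y * specProj ρ s ≠ 0 →
      r ^ z * s ^ (-z) = μ := by
    intro r _ s _ h0
    have h1 := congrArg (fun y => specProj ρ r * y * specProj ρ s) hyμ
    simp only [hU] at h1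
    rw [← mul_assoc, ← mul_assoc, pow, ← funCalc, specProj_mul_funCalc, pow, ← funCalc, mul_assoc,
      funCalc_mul_specProj] at h1
    simp only [smul_mul_assoc, mul_smul_comm, ← mul_smul] at h1
    rw [mul_comm]
    exact smul_left_injective ℂ h0 h1
  by_cases hex : ∃ r ∈ spec ρ, ∃ s ∈ spec ρ, specProj ρ r * y * specProj ρ s ≠ 0
  · obtain ⟨r, hr, s, hs, h0⟩ := hex
    have hμ := hc r hr s hs h0
    obtain ⟨r₀, hr₀, hrr⟩ := exists_pos_of_mem_spec hρ hu hr
    obtain ⟨s₀, hs₀, hss⟩ := exists_pos_of_mem_spec hρ hu hs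
    -- Any nonzero block gives the eigenvalue, as all of them share the ratio.
    refine ⟨r₀ / s₀, div_pos hr₀ hs₀, eq_of_specProj hρ fun r' hr' s' hs' => ?_⟩
    have e1 : specProj ρ r' * (ρ * y) * specProj ρ s'
        = r' • (specProj ρ r' * y * specProj ρ s') := by
      rw [← mul_assoc, specProj_mul_self hρ, smul_mul_assoc, smul_mul_assoc]
    have e2 : specProj ρ r' * (y * ρ) * specProj ρ s'
        = s' • (specProj ρ r' * y * specProj ρ s') := by
      rw [mul_assoc, mul_assoc y, self_mul_specProj hρ, mul_smul_comm, mul_smul_comm, mul_assoc]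
    rw [e1, mul_smul_comm, smul_mul_assoc, e2, ← mul_smul]
    by_cases h0' : specProj ρ r' * y * specProj ρ s' = 0
    · rw [h0', smul_zero, smul_zero]
    · congr 1
      have h2 := hz r' hr' s' hs' r hr s hs ((hc r' hr' s' hs' h0').trans hμ.symm)
      have h3 := ne_zero_of_mem_spec hρ hu hs
      push_cast
      rw [← hrr, ← hss]
      field_simp
      exact h2
  · push Not at hex
    refine ⟨1, one_pos, ?_⟩
    have : y = 0 := eq_of_specProj hρ fun r hr s hs => by rw [hex r hr s hs]; simp
    simp [this]

theorem le_span_eigenIn_of_modular (W : Submodule ℂ A)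
    (hW : ∀ a ∈ W, ∀ b, b * ρ = ρ * a → b ∈ W) : W ≤ Submodule.span ℂ (eigenIn ρ W) := by
  refine le_span_eigenIn hρ hu W 1 ?_ ?_
  · intro r hr s hs r' hr' s' hs' h
    have h1 := ne_zero_of_mem_spec hρ hu hs
    have h2 := ne_zero_of_mem_spec hρ hu hs'
    simp only [Complex.cpow_one, Complex.cpow_neg] at h
    field_simp at h
    rw [h, mul_comm]
  · intro x hx
    refine hW x hx _ ?_
    have := pow_neg_mul_pow hρ hu 1
    rw [pow_one' hρ] at this ⊢
    rw [mul_assoc, this, mul_one]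

/-- Conjugation scales an eigenvector by `l ^ z`. This plays the role of analytic continuation of
the modular group. -/
theorem pow_mul_pow_neg_mem (W : Submodule ℂ A) (hW : W ≤ Submodule.span ℂ (eigenIn ρ W)) (z : ℂ)
    {x : A} (hx : x ∈ W) : pow ρ z * x * pow ρ (-z) ∈ W := by
  have hx' := hW hx
  clear hx
  induction hx' using Submodule.span_induction with
  | mem y hy =>
    obtain ⟨hyW, l, hl, hly⟩ := hy
    rw [pow_mul_of_eigen hρ hu hl hly, smul_mul_assoc, mul_assoc, pow_mul_pow_neg hρ hu, mul_one]
    exact W.smul_mem _ hyW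
  | zero => simp
  | add y z _ _ h1 h2 => rw [mul_add, add_mul]; exact W.add_mem h1 h2
  | smul c y _ h1 => rw [mul_smul_comm, smul_mul_assoc]; exact W.smul_mem c h1

/-- A single small time suffices: the eigenvalues are `exp(i t (log r - log s))`, and they determine
`r / s` once all the angles lie in `(-π, π)`. -/
theorem le_span_eigenIn_of_unitary (W : Submodule ℂ A)
    (hW : ∀ t : ℝ, ∀ x ∈ W, pow ρ (Complex.I * t) * x * pow ρ (-(Complex.I * t)) ∈ W) :
    W ≤ Submodule.span ℂ (eigenIn ρ W) := by
  set S : ℝ := ∑ r ∈ spec ρ, ∑ s ∈ spec ρ, |Real.log r.re - Real.log s.re| with hS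
  have hS0 : 0 ≤ S := Finset.sum_nonneg fun _ _ => Finset.sum_nonneg fun _ _ => abs_nonneg _
  -- `S` dominates every `|log r - log s|`, so all the angles are at most `1 < π`.
  set t : ℝ := 1 / (1 + S) with ht
  have ht0 : 0 < t := by positivity
  have hbound : ∀ r ∈ spec ρ, ∀ s ∈ spec ρ, |t * (Real.log r.re - Real.log s.re)| < Real.pi := by
    intro r hr s hs
    have h1 : |Real.log r.re - Real.log s.re| ≤ S :=
      (Finset.single_le_sum (f := fun s : ℂ => |Real.log r.re - Real.log s.re|)
        (fun _ _ => abs_nonneg _) hs).trans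
      (Finset.single_le_sum (f := fun r : ℂ => ∑ s ∈ spec ρ, |Real.log r.re - Real.log s.re|)
        (fun _ _ => Finset.sum_nonneg fun _ _ => abs_nonneg _) hr)
    rw [abs_mul, abs_of_pos ht0]
    calc t * |Real.log r.re - Real.log s.re| ≤ t * (1 + S) := by gcongr; linarith
      _ = 1 := by rw [ht]; field_simp
      _ < Real.pi := by linarith [Real.pi_gt_three]
  have hexp : ∀ r ∈ spec ρ, ∀ s ∈ spec ρ, r ^ (Complex.I * t) * s ^ (-(Complex.I * t))
      = Complex.exp ((t * (Real.log r.re - Real.log s.re) : ℝ) * Complex.I) := by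
    intro r hr s hs
    obtain ⟨x, hx, rfl⟩ := exists_pos_of_mem_spec hρ hu hr
    obtain ⟨y, hy, rfl⟩ := exists_pos_of_mem_spec hρ hu hs
    rw [Complex.cpow_def_of_ne_zero (by exact_mod_cast hx.ne'),
      Complex.cpow_def_of_ne_zero (by exact_mod_cast hy.ne'), ← Complex.exp_add,
      ← Complex.ofReal_log hx.le, ← Complex.ofReal_log hy.le]
    congr 1
    push_cast [Complex.ofReal_re]
    ring
  refine le_span_eigenIn hρ hu W (Complex.I * t) ?_ (hW t)
  intro r hr s hs r' hr' s' hs' h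
  rw [hexp r hr s hs, hexp r' hr' s' hs'] at h
  have b1 := abs_lt.mp (hbound r hr s hs)
  have b2 := abs_lt.mp (hbound r' hr' s' hs')
  have h1 := congrArg Complex.log h
  rw [Complex.log_exp (by simpa using b1.1) (by simpa using b1.2.le),
    Complex.log_exp (by simpa using b2.1) (by simpa using b2.2.le)] at h1
  have h2 := Complex.ofReal_injective (mul_right_cancel₀ Complex.I_ne_zero h1)
  have h3 := mul_left_cancel₀ ht0.ne' h2
  obtain ⟨x, hx, rfl⟩ := exists_pos_of_mem_spec hρ hu hr
  obtain ⟨y, hy, rfl⟩ := exists_pos_of_mem_spec hρ hu hs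
  obtain ⟨x', hx', rfl⟩ := exists_pos_of_mem_spec hρ hu hr'
  obtain ⟨y', hy', rfl⟩ := exists_pos_of_mem_spec hρ hu hs'
  simp only [Complex.ofReal_re] at h3
  have h4 : Real.log (x * y') = Real.log (x' * y) := by
    rw [Real.log_mul hx.ne' hy'.ne', Real.log_mul hx'.ne' hy.ne']
    linarith
  have h5 := Real.log_injOn_pos (Set.mem_Ioi.mpr (mul_pos hx hy'))
    (Set.mem_Ioi.mpr (mul_pos hx' hy)) h4
  exact_mod_cast h5

end

/-! ### Maps with Schwarz adjoint, and the Petz dual on modular eigenvectors. -/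

theorem hsAdjoint_hsAdjoint (T : A →ₗ[ℂ] B) : hsAdjoint (hsAdjoint T) = T := by
  refine (eq_hsAdjoint _ _ fun a b => ?_).symm
  have := congrArg star (hsAdjoint_spec T b a)
  rw [← tr_star, ← tr_star] at this
  simpa only [star_mul, star_star] using this.symm

theorem hsAdjoint_spec' (T : A →ₗ[ℂ] B) (a : A) (b : B) :
    tr B (star (T a) * b) = tr A (star a * hsAdjoint T b) := by
  have := hsAdjoint_spec (hsAdjoint T) a b
  rwa [hsAdjoint_hsAdjoint] at this

section Dual

variable {T : A →ₗ[ℂ] B} (hT : IsUnitalSchwarz (hsAdjoint T))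
include hT

theorem tr_hsAdjoint_mul (b : B) (a : A) : tr A (hsAdjoint T b * a) = tr B (b * T a) := by
  have := hsAdjoint_spec T (star b) a
  rwa [hT.map_star, star_star, star_star] at this

theorem tr_map_of_schwarz (a : A) : tr B (T a) = tr A a := by
  have := tr_hsAdjoint_mul hT 1 a
  rw [hT.1, one_mul, one_mul] at this
  exact this.symm

theorem map_nonneg_of_schwarz {ρ : A} (hρ : 0 ≤ (ρ : H →L[ℂ] H)) : 0 ≤ (T ρ : K →L[ℂ] K) := by
  refine nonneg_of_tr_nonneg _ fun y => ?_
  rw [tr_mul_comm, ← mul_assoc, ← tr_hsAdjoint_mul hT, tr_mul_comm]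
  refine tr_mul_nonneg _ _ hρ (hT.map_nonneg _ ?_)
  simp

/-- Dual form of the multiplicativity of `T*` at elements of its multiplicative domain. -/
theorem map_hsAdjoint_mul {b : B} (hb : b ∈ multDomain (hsAdjoint T)) (ρ : A) :
    T (hsAdjoint T b * ρ) = b * T ρ := by
  refine eq_of_tr_mul _ _ fun c => ?_
  rw [← hsAdjoint_spec, ← hT.map_star, ← mul_assoc, ← hT.map_mul_of_eq b hb.1,
    tr_hsAdjoint_mul hT, mul_assoc]

theorem map_mul_hsAdjoint {b : B} (hb : b ∈ multDomain (hsAdjoint T)) (ρ : A) :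
    T (ρ * hsAdjoint T b) = T ρ * b := by
  refine eq_of_tr_mul _ _ fun c => ?_
  rw [← hsAdjoint_spec, ← hT.map_star, ← mul_assoc, tr_mul_comm, ← mul_assoc,
    ← hT.mul_map_of_eq b hb.2, tr_hsAdjoint_mul hT, tr_mul_comm, ← mul_assoc, tr_mul_comm,
    ← mul_assoc, tr_mul_comm]

variable {ρ : A} (hρ : 0 ≤ (ρ : H →L[ℂ] H)) (hu : IsUnit ρ) (hu' : IsUnit (T ρ))
include hρ hu hu'

/-- By the module property, `b` is an eigenvector for `T ρ` with the same `l`. The half powers on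
the left can then be moved to the right on both sides, at the same cost `l ^ (1/2)`, and they
cancel. -/
theorem petzDual_hsAdjoint {b : B} (hb : b ∈ multDomain (hsAdjoint T)) {l : ℝ} (hl : 0 < l)
    (h : ρ * hsAdjoint T b = (l : ℂ) • (hsAdjoint T b * ρ)) :
    petzDual T ρ (hsAdjoint T b) = b := by
  have hρ' := map_nonneg_of_schwarz hT hρ
  have hb' : T ρ * b = (l : ℂ) • (b * T ρ) := by
    rw [← map_mul_hsAdjoint hT hb, h, map_smul, map_hsAdjoint_mul hT hb]
  have e1 := pow_mul_of_eigen hρ hu hl h (1 / 2)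
  have e2 := pow_mul_of_eigen hρ' hu' hl hb' (1 / 2)
  have e3 : T (pow ρ (1 / 2) * hsAdjoint T b * pow ρ (1 / 2))
      = pow (T ρ) (1 / 2) * b * pow (T ρ) (1 / 2) := by
    rw [e1, e2, smul_mul_assoc, smul_mul_assoc, mul_assoc, mul_assoc,
      pow_half_mul_pow_half hρ hu, pow_half_mul_pow_half hρ' hu', map_smul,
      map_hsAdjoint_mul hT hb]
  change pow (T ρ) (-1 / 2) * T (pow ρ (1 / 2) * hsAdjoint T b * pow ρ (1 / 2))
    * pow (T ρ) (-1 / 2) = b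
  rw [e3, mul_assoc, mul_assoc _ (pow (T ρ) (1 / 2)), pow_half_mul_pow_neg_half hρ' hu', mul_one,
    ← mul_assoc, pow_neg_half_mul_pow_half hρ' hu', one_mul]

/-- Serves twice: for `T` itself, and for the trace-preserving conditional expectation onto a
modular-invariant subalgebra. -/
theorem hsAdjoint_petzDual_of_mem {W : Submodule ℂ A}
    (hW : W ≤ Submodule.span ℂ (eigenIn ρ W))
    (hWT : ∀ x ∈ W, x ∈ hsAdjoint T '' multDomain (hsAdjoint T)) {x : A} (hx : x ∈ W) :
    hsAdjoint T (petzDual T ρ x) = x := by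
  have hx' := hW hx
  clear hx
  induction hx' using Submodule.span_induction with
  | mem y hy =>
    obtain ⟨hyW, l, hl, hly⟩ := hy
    obtain ⟨b, hb, rfl⟩ := hWT y hyW
    rw [petzDual_hsAdjoint hT hρ hu hu' hb hl hly]
  | zero => simp
  | add y z _ _ h1 h2 => rw [map_add, map_add, h1, h2]
  | smul c y _ h1 => rw [map_smul, map_smul, h1]

end Dual

theorem IsUnitalSchwarz.add_mem_multDomain {φ : A →ₗ[ℂ] B} (hφ : IsUnitalSchwarz φ) {a b : A}
    (ha : a ∈ multDomain φ) (hb : b ∈ multDomain φ) : a + b ∈ multDomain φ := by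
  constructor
  · rw [mul_add, map_add, hφ.map_mul_of_eq a ha.1, hφ.map_mul_of_eq b hb.1, hφ.map_star, ← mul_add,
      ← map_add]
  · rw [add_mul, map_add, hφ.mul_map_of_eq a ha.2, hφ.mul_map_of_eq b hb.2, hφ.map_star, ← add_mul,
      ← map_add]

theorem smul_mem_multDomain {φ : A →ₗ[ℂ] B} {a : A} (ha : a ∈ multDomain φ) (z : ℂ) :
    z • a ∈ multDomain φ := by
  constructor
  · simp only [star_smul, map_smul, smul_mul_assoc, mul_smul_comm, ha.1]
  · simp only [star_smul, map_smul, smul_mul_assoc, mul_smul_comm, ha.2]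

/-! ### Complete positivity -/

section CP

variable {L : Type*} [NormedAddCommGroup L] [InnerProductSpace ℂ L] [CompleteSpace L]
  [FiniteDimensional ℂ L] {C : StarSubalgebra ℂ (L →L[ℂ] L)}

theorem IsCP.comp {S : B →ₗ[ℂ] C} {T : A →ₗ[ℂ] B} (hS : IsCP S) (hT : IsCP T) : IsCP (S ∘ₗ T) :=
  fun n M hM => hS n (M.map T) (hT n M hM)

theorem isCP_conj (v : A) : IsCP (LinearMap.mulRight ℂ v ∘ₗ LinearMap.mulLeft ℂ (star v)) := by
  intro n M hM x
  refine (hM fun i => (v : H →L[ℂ] H) (x i)).trans_eq ?_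
  refine Finset.sum_congr rfl fun i _ => Finset.sum_congr rfl fun j _ => ?_
  simp only [Matrix.map_apply, LinearMap.comp_apply, LinearMap.mulLeft_apply,
    LinearMap.mulRight_apply, MulMemClass.coe_mul, StarMemClass.coe_star, mul_assoc,
    ContinuousLinearMap.star_eq_adjoint, _root_.mul_apply_eq_comp,
    ContinuousLinearMap.adjoint_inner_right]

/-- The adjoint of a star homomorphism is completely positive. -/
theorem isCP_hsAdjoint (π : A →ₗ[ℂ] B) (hmul : ∀ x y, π (x * y) = π x * π y)
    (hstar : ∀ x, π (star x) = star (π x)) : IsCP (hsAdjoint π) := by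
  intro n M hM
  refine matPos_of_form_nonneg fun y => (hM.form_nonneg fun i => π (y i)).trans_eq ?_
  refine Finset.sum_congr rfl fun i _ => Finset.sum_congr rfl fun j _ => ?_
  rw [tr_mul_comm, ← mul_assoc, tr_mul_comm _ (y j), ← mul_assoc, ← hstar, ← hmul,
    ← star_star (y j * star (y i)), hstar, hsAdjoint_spec', Matrix.map_apply]

/-- Pair `S` of the positive matrix `(y_i* y_j)` with the `x_i`: size one gives positivity of `S*`,
size two the Schwarz inequality, and trace preservation gives the unit. -/
theorem IsCPTP.isUnitalSchwarz {S : B →ₗ[ℂ] A} (hS : IsCPTP S) :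
    IsUnitalSchwarz (hsAdjoint S) := by
  have hform : ∀ (n : ℕ) (x : Fin n → A) (y : Fin n → B),
      0 ≤ ∑ i, ∑ j, tr B (star (hsAdjoint S (x i * star (x j))) * (star (y i) * y j)) := by
    intro n x y
    have h1 : MatPos (Matrix.of fun i j => star (y i) * y j) :=
      matPos_of_eq_sum (fun (_ : Fin 1) => y) (by simp)
    refine ((hS.1 n _ h1).form_nonneg x).trans_eq ?_
    refine Finset.sum_congr rfl fun i _ => Finset.sum_congr rfl fun j _ => ?_
    rw [hsAdjoint_spec, star_mul, star_star, tr_mul_comm, ← mul_assoc]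
    rfl
  have hpos : ∀ a : A, 0 ≤ (hsAdjoint S (star a * a) : K →L[ℂ] K) := by
    intro a
    have h1 : 0 ≤ ((star (hsAdjoint S (star a * a)) : B) : K →L[ℂ] K) := by
      refine nonneg_of_tr_nonneg _ fun z => ?_
      have := hform 1 (fun _ => star a) (fun _ => star z)
      rw [mul_assoc, tr_mul_comm, mul_assoc]
      simpa using this
    rwa [← star_eq_of_nonneg _ h1, star_star] at h1
  have hstar := map_star_of_nonneg hpos
  have hone : hsAdjoint S 1 = 1 := by
    refine eq_of_tr_mul _ _ fun c => ?_
    rw [← hsAdjoint_spec', mul_one, mul_one, tr_star, tr_star, hS.2]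
  refine ⟨hone, fun a => ?_⟩
  have h1 : 0 ≤ ((hsAdjoint S (star a * a) - star (hsAdjoint S a) * hsAdjoint S a : B) :
      K →L[ℂ] K) := by
    refine nonneg_of_tr_nonneg _ fun z => ?_
    -- The `x_i` produce the positive matrix with rows `(1, a)` and `(a*, a* a)`; the first `y`
    -- completes the square, leaving the Schwarz defect.
    have h2 := hform 2 ![1, star a] ![-(star z * star (hsAdjoint S a)), star z]
    have h3 : star (hsAdjoint S (star a * a)) = hsAdjoint S (star a * a) := by
      rw [← hstar, star_mul, star_star]
    simp only [Fin.sum_univ_two, Matrix.cons_val_zero, Matrix.cons_val_one, star_one, mul_one,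
      one_mul, star_star, h3, hone, star_neg, star_mul, neg_mul, mul_neg, neg_neg, map_neg,
      hstar] at h2
    have e1 : tr B (hsAdjoint S a * z * (star z * star (hsAdjoint S a)))
        = tr B (star (hsAdjoint S a) * (hsAdjoint S a * z * star z)) := by
      rw [← mul_assoc, tr_mul_comm]
    have e2 : tr B (hsAdjoint S a * (z * (star z * star (hsAdjoint S a))))
        = tr B (star (hsAdjoint S a) * (hsAdjoint S a * z * star z)) := by
      rw [← mul_assoc, ← mul_assoc, tr_mul_comm]
    rw [e1, e2] at h2
    rw [mul_assoc, tr_mul_comm, mul_assoc, sub_mul, map_sub, mul_assoc (star (hsAdjoint S a)),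
      ← mul_assoc (hsAdjoint S a)]
    refine h2.trans_eq ?_
    ring
  simpa using h1

end CP

/-! ### Conditional expectations and channels from modular-invariant subalgebras. -/

section Inclusion

variable {N : StarSubalgebra ℂ (H →L[ℂ] H)}

/-- The inclusion of a subalgebra. -/
def incl (h : N ≤ A) : N →ₗ[ℂ] A where
  toFun x := ⟨x, h x.2⟩
  map_add' _ _ := rfl
  map_smul' _ _ := rfl

theorem incl_injective (h : N ≤ A) : Function.Injective (incl h) := fun _ _ hxy =>
  Subtype.ext (congrArg (fun y : A => (y : H →L[ℂ] H)) hxy)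

theorem incl_isUnitalSchwarz (h : N ≤ A) : IsUnitalSchwarz (incl h) :=
  ⟨rfl, fun _ => le_rfl⟩

theorem mem_multDomain_incl (h : N ≤ A) (x : N) : x ∈ multDomain (incl h) := ⟨rfl, rfl⟩

theorem isCP_incl (h : N ≤ A) : IsCP (incl h) := fun _ _ hM => hM

/-- If `E(ρ) x = 0` then `Tr ρ x x* = Tr E(ρ) x x* = 0`, so `x = 0`. In finite dimension this gives
a right inverse, and self-adjointness makes it two-sided. -/
theorem isUnit_hsAdjoint_incl (h : N ≤ A) {ρ : A} (hρ : 0 ≤ (ρ : H →L[ℂ] H)) (hu : IsUnit ρ) :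
    IsUnit (hsAdjoint (incl h) ρ) := by
  have hE : IsUnitalSchwarz (hsAdjoint (hsAdjoint (incl h))) := by
    rw [hsAdjoint_hsAdjoint]; exact incl_isUnitalSchwarz h
  set σ := hsAdjoint (incl h) ρ with hσ
  have hs : star σ = σ := star_eq_of_nonneg _ (map_nonneg_of_schwarz hE hρ)
  have hinj : Function.Injective (LinearMap.mulLeft ℂ σ) := by
    rw [injective_iff_map_eq_zero]
    intro x hx
    have h1 : tr A (incl h (x * star x) * ρ) = 0 := by
      have := tr_hsAdjoint_mul hE (x * star x) ρ
      rw [hsAdjoint_hsAdjoint] at this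
      rw [this, ← hσ, tr_mul_comm, ← mul_assoc, show σ * x = 0 from hx, zero_mul, map_zero]
    rw [tr_mul_comm] at h1
    have h2 : 0 ≤ (incl h (x * star x) : H →L[ℂ] H) := by
      have := star_mul_self_coe_nonneg (star x)
      rwa [star_star] at this
    have h3 := incl_injective h
      ((eq_zero_of_tr_mul_eq_zero ρ _ hρ hu h2 h1).trans (map_zero (incl h)).symm)
    have h4 := tr_star_mul_self_eq_zero (star x) (by rw [star_star, h3, map_zero])
    exact star_eq_zero.mp h4
  obtain ⟨y, hy⟩ := LinearMap.injective_iff_surjective.mp hinj 1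
  have hy : σ * y = 1 := hy
  have hy' : star y * σ = 1 := by
    have := congrArg star hy
    rwa [star_mul, hs, star_one] at this
  exact isUnit_iff_exists.mpr ⟨y, hy, by rw [← left_inv_eq_right_inv hy' hy, hy']⟩

end Inclusion

/-- Let `N` be a subalgebra of `A` that is invariant under the modular group of `ρ`, and `π` a star
homomorphism of `N` into `B`. Composing the adjoint of `π` with the adjoint of the
`ρ`-preserving conditional expectation onto `N` gives a channel. -/
theorem exists_isCPTP_of_modular {N : StarSubalgebra ℂ (H →L[ℂ] H)} (hN : N ≤ A) {ρ : A}
    (hρ : 0 ≤ (ρ : H →L[ℂ] H)) (hu : IsUnit ρ)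
    (hmod : ∀ (x : N) (b : A), b * ρ = ρ * incl hN x → ∃ y, incl hN y = b)
    (π : N →ₗ[ℂ] B) (hone : π 1 = 1) (hmul : ∀ x y, π (x * y) = π x * π y)
    (hstar : ∀ x, π (star x) = star (π x)) :
    ∃ R : B →ₗ[ℂ] A, IsCPTP R ∧ ∀ (a : N) (b : B),
      (∀ n : N, tr B (star (π n) * b)
        = tr A (star (incl hN n) * (pow ρ (1 / 2) * incl hN a * pow ρ (1 / 2)))) →
      R b = pow ρ (1 / 2) * incl hN a * pow ρ (1 / 2) := by
  set E := hsAdjoint (incl hN) with hEdef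
  have hEι : hsAdjoint E = incl hN := hsAdjoint_hsAdjoint _
  have hE : IsUnitalSchwarz (hsAdjoint E) := by rw [hEι]; exact incl_isUnitalSchwarz hN
  have hσ : 0 ≤ (E ρ : H →L[ℂ] H) := map_nonneg_of_schwarz hE hρ
  have hσu : IsUnit (E ρ) := isUnit_hsAdjoint_incl hN hρ hu
  -- Modular invariance of `N` enters here: it makes the Petz dual of `E` the identity on `N`.
  have hpetz : ∀ a : N, petzDual E ρ (incl hN a) = a := by
    intro a
    apply incl_injective hN
    rw [← hEι]
    refine hsAdjoint_petzDual_of_mem hE hρ hu hσu (W := LinearMap.range (incl hN))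
      (le_span_eigenIn_of_modular hρ hu _ ?_) ?_ ?_
    · rintro _ ⟨x, rfl⟩ b hb
      exact hmod x b hb
    · rintro _ ⟨x, rfl⟩
      rw [hEι]
      exact ⟨x, mem_multDomain_incl hN x, rfl⟩
    · rw [hEι]; exact ⟨a, rfl⟩
  let conj {M : StarSubalgebra ℂ (H →L[ℂ] H)} (v : M) : M →ₗ[ℂ] M :=
    LinearMap.mulRight ℂ v ∘ₗ LinearMap.mulLeft ℂ (star v)
  -- The adjoint of `π ∘ petzDual E ρ`, written as a composite of completely positive maps.
  let R : B →ₗ[ℂ] A := conj (pow ρ (1 / 2)) ∘ₗ incl hN ∘ₗ conj (pow (E ρ) (-1 / 2)) ∘ₗ hsAdjoint π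
  have hR : ∀ b, R b = pow ρ (1 / 2)
      * incl hN (pow (E ρ) (-1 / 2) * hsAdjoint π b * pow (E ρ) (-1 / 2)) * pow ρ (1 / 2) := by
    intro b
    change star (pow ρ (1 / 2)) * incl hN (star (pow (E ρ) (-1 / 2)) * hsAdjoint π b
      * pow (E ρ) (-1 / 2)) * pow ρ (1 / 2) = _
    rw [star_pow_half hρ hu, star_pow_neg_half hσ hσu]
  refine ⟨R, ⟨(isCP_conj _).comp ((isCP_incl hN).comp ((isCP_conj _).comp
    (isCP_hsAdjoint π hmul hstar))), fun b => ?_⟩, fun a b hab => ?_⟩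
  · have e1 := pow_neg_half_mul_self_mul_pow_neg_half hσ hσu
    rw [hR, tr_mul_comm, ← mul_assoc, pow_half_mul_pow_half hρ hu, tr_mul_comm, ← hEι,
      tr_hsAdjoint_mul hE, mul_assoc, mul_assoc, tr_mul_comm, mul_assoc, mul_assoc,
      ← mul_assoc _ (E ρ), e1, mul_one]
    have := hsAdjoint_spec' π 1 b
    rw [hone] at this
    simpa using this.symm
  -- The test against `N` determines `π*(b)`, which turns the inner factor of `R b` into the Petz
  -- dual of `E` at `a`.
  · have e1 : hsAdjoint π b = E (pow ρ (1 / 2) * incl hN a * pow ρ (1 / 2)) := by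
      refine eq_of_tr_mul _ _ fun n => ?_
      rw [← hsAdjoint_spec', hab, hEdef, ← hsAdjoint_spec']
    rw [hR, e1, show pow (E ρ) (-1 / 2) * E (pow ρ (1 / 2) * incl hN a * pow ρ (1 / 2))
      * pow (E ρ) (-1 / 2) = a from hpetz a]

/-! ### Channels attached to an invariant pair. -/

namespace IsInvariantPair

variable {ρ : A} {ρ' : B} {α : B →ₗ[ℂ] A} {β : A →ₗ[ℂ] B} (h : IsInvariantPair ρ ρ' α β)
include h

/-- The fixed points of `α ∘ β`, as a subalgebra of `B(H)`. -/
def fixedAlg : StarSubalgebra ℂ (H →L[ℂ] H) where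
  carrier := Subtype.val '' fixedPts (α ∘ₗ β)
  mul_mem' := by
    rintro _ _ ⟨a, ha, rfl⟩ ⟨b, hb, rfl⟩
    exact ⟨a * b, h.mul_mem ha hb, rfl⟩
  add_mem' := by
    rintro _ _ ⟨a, ha, rfl⟩ ⟨b, hb, rfl⟩
    exact ⟨a + b, (map_add (α ∘ₗ β) a b).trans (congrArg₂ _ ha hb), rfl⟩
  algebraMap_mem' z := by
    refine ⟨z • (1 : A), ?_, (Algebra.algebraMap_eq_smul_one z).symm⟩
    rw [fixedPts, Set.mem_ofPred_eq, map_smul, h.schwarz_comp.1]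
  star_mem' := by
    rintro _ ⟨a, ha, rfl⟩
    exact ⟨star a, h.star_mem ha, rfl⟩

theorem fixedAlg_le : h.fixedAlg ≤ A := by
  rintro _ ⟨a, _, rfl⟩
  exact a.2

theorem incl_fixedAlg_mem (x : h.fixedAlg) : incl h.fixedAlg_le x ∈ fixedPts (α ∘ₗ β) := by
  obtain ⟨_, a, ha, rfl⟩ := x
  exact ha

theorem exists_incl_eq {a : A} (ha : a ∈ fixedPts (α ∘ₗ β)) :
    ∃ x, incl h.fixedAlg_le x = a := ⟨⟨a, a, ha, rfl⟩, rfl⟩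

theorem exists_isCPTP : ∃ R : B →ₗ[ℂ] A, IsCPTP R ∧ ∀ a ∈ fixedPts (α ∘ₗ β), ∀ b : B,
    (∀ n ∈ fixedPts (α ∘ₗ β), tr B (star (β n) * b)
      = tr A (star n * (pow ρ (1 / 2) * a * pow ρ (1 / 2)))) →
    R b = pow ρ (1 / 2) * a * pow ρ (1 / 2) := by
  obtain ⟨R, hR, hRb⟩ := exists_isCPTP_of_modular h.fixedAlg_le h.nonneg h.isUnit
    (fun x b hb => h.exists_incl_eq (h.modular_mem (h.incl_fixedAlg_mem x) hb))
    (β ∘ₗ incl h.fixedAlg_le) h.schwarz'.1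
    (fun x y => h.map_mul_of_mem (h.incl_fixedAlg_mem y) (incl h.fixedAlg_le x))
    (fun x => h.schwarz'.map_star (incl h.fixedAlg_le x))
  refine ⟨R, hR, fun a ha b hab => ?_⟩
  obtain ⟨x, rfl⟩ := h.exists_incl_eq ha
  exact hRb x b fun n => hab _ (h.incl_fixedAlg_mem n)

end IsInvariantPair

/-! ### Radon–Nikodym derivatives and the reversibility conditions. -/

theorem pow_half_mul_rnDer_mul_pow_half (σ : A) {ρ : A} (hρ : 0 ≤ (ρ : H →L[ℂ] H))
    (hu : IsUnit ρ) : pow ρ (1 / 2) * rnDer σ ρ * pow ρ (1 / 2) = σ := by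
  rw [rnDer, mul_assoc, mul_assoc, pow_neg_half_mul_pow_half hρ hu, mul_one, ← mul_assoc,
    pow_half_mul_pow_neg_half hρ hu, one_mul]

theorem petzDual_rnDer (T : A →ₗ[ℂ] B) (σ : A) {ρ : A} (hρ : 0 ≤ (ρ : H →L[ℂ] H))
    (hu : IsUnit ρ) : petzDual T ρ (rnDer σ ρ) = rnDer (T σ) (T ρ) := by
  change _ * T (pow ρ (1 / 2) * rnDer σ ρ * pow ρ (1 / 2)) * _ = _
  rw [pow_half_mul_rnDer_mul_pow_half σ hρ hu, rnDer]

section Reversibility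

variable {T : A →ₗ[ℂ] B} (hT : IsUnitalSchwarz (hsAdjoint T)) {ρ : A}
  (hρ : 0 ≤ (ρ : H →L[ℂ] H)) (hu : IsUnit ρ) (hu' : IsUnit (T ρ))
include hT hρ hu hu'

theorem isInvariantPair_petzDual (hTρ : IsUnitalSchwarz (petzDual T ρ)) :
    IsInvariantPair ρ (T ρ) (hsAdjoint T) (petzDual T ρ) where
  nonneg := hρ
  isUnit := hu
  nonneg' := map_nonneg_of_schwarz hT hρ
  isUnit' := hu'
  schwarz := hT
  schwarz' := hTρ
  tr_map b := by rw [tr_mul_comm, tr_hsAdjoint_mul hT, tr_mul_comm]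
  tr_map' a := by
    have hρ' := map_nonneg_of_schwarz hT hρ
    have e1 := pow_neg_half_mul_self_mul_pow_neg_half hρ' hu'
    change tr B (T ρ * (pow (T ρ) (-1 / 2) * T (pow ρ (1 / 2) * a * pow ρ (1 / 2))
      * pow (T ρ) (-1 / 2))) = _
    rw [← mul_assoc, tr_mul_comm, ← mul_assoc, ← mul_assoc, e1, one_mul, tr_map_of_schwarz hT,
      tr_mul_comm, ← mul_assoc, pow_half_mul_pow_half hρ hu]

theorem isInvariantPair_of_recovery {S : B →ₗ[ℂ] A} (hS : IsUnitalSchwarz (hsAdjoint S))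
    (hSρ : S (T ρ) = ρ) : IsInvariantPair ρ (T ρ) (hsAdjoint T) (hsAdjoint S) where
  nonneg := hρ
  isUnit := hu
  nonneg' := map_nonneg_of_schwarz hT hρ
  isUnit' := hu'
  schwarz := hT
  schwarz' := hS
  tr_map b := by rw [tr_mul_comm, tr_hsAdjoint_mul hT, tr_mul_comm]
  tr_map' a := by rw [tr_mul_comm, tr_hsAdjoint_mul hS, hSρ, tr_mul_comm]

theorem modular_orbit_mem_of_recovery {S : B →ₗ[ℂ] A} (hS : IsUnitalSchwarz (hsAdjoint S))
    (hSρ : S (T ρ) = ρ) {σ : A} (hσ : S (T σ) = σ) (z : ℂ) :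
    pow ρ z * rnDer σ ρ * pow ρ (-z) ∈ hsAdjoint T '' multDomain (hsAdjoint T) := by
  have h := isInvariantPair_of_recovery hT hρ hu hu' hS hSρ
  set W : Submodule ℂ A := LinearMap.eqLocus (hsAdjoint T ∘ₗ hsAdjoint S) LinearMap.id
  have hspan : W ≤ Submodule.span ℂ (eigenIn ρ W) :=
    le_span_eigenIn_of_modular hρ hu W fun a ha b hb => h.modular_mem ha hb
  -- Multiplied by `ρ` this is `σ`, which is fixed by `S ∘ T`, the adjoint of `T* ∘ S*`.
  have ha : σ * pow ρ (-1) ∈ W := by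
    refine h.mem_fixedPts_of_tr fun c => ?_
    have e1 : σ * pow ρ (-1) * ρ = σ := by
      have := pow_neg_mul_pow hρ hu 1
      rw [pow_one' hρ] at this
      rw [mul_assoc, this, mul_one]
    rw [e1]
    change tr A (hsAdjoint T (hsAdjoint S c) * σ) = _
    rw [tr_hsAdjoint_mul hT, tr_hsAdjoint_mul hS, hσ]
  have hd : rnDer σ ρ ∈ W := by
    -- Conjugating `σ ρ⁻¹` by `ρ ^ (-1/2)` gives `d(σ, ρ)`.
    have := pow_mul_pow_neg_mem hρ hu W hspan (-1 / 2) ha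
    rw [mul_assoc, mul_assoc σ, pow_mul_pow hρ hu, ← mul_assoc] at this
    norm_num at this
    rwa [rnDer, neg_div]
  have hx := pow_mul_pow_neg_mem hρ hu W hspan z hd
  exact ⟨_, h.map_mem_multDomain hx, hx⟩

/-- The elements whose whole orbit lies in `T*(ℳ)` form a subspace stable under the modular group,
hence one spanned by modular eigenvectors, where `T* ∘ T_ρ` acts trivially. -/
theorem mem_fixedPts_of_modular_orbit {d : A} (hd : ∀ t : ℝ,
    pow ρ (Complex.I * t) * d * pow ρ (-(Complex.I * t)) ∈
      hsAdjoint T '' multDomain (hsAdjoint T)) :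
    d ∈ fixedPts (hsAdjoint T ∘ₗ petzDual T ρ) := by
  let W : Submodule ℂ A :=
    { carrier := {x | ∀ t : ℝ, pow ρ (Complex.I * t) * x * pow ρ (-(Complex.I * t)) ∈
        hsAdjoint T '' multDomain (hsAdjoint T)}
      add_mem' := by
        intro x y hx hy t
        obtain ⟨b, hb, hb'⟩ := hx t
        obtain ⟨c, hc, hc'⟩ := hy t
        exact ⟨b + c, hT.add_mem_multDomain hb hc, by rw [map_add, hb', hc', mul_add, add_mul]⟩
      zero_mem' := fun t => ⟨0, by simp [multDomain], by simp⟩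
      smul_mem' := by
        intro z x hx t
        obtain ⟨b, hb, hb'⟩ := hx t
        exact ⟨z • b, smul_mem_multDomain hb z, by
          rw [map_smul, hb', mul_smul_comm, smul_mul_assoc]⟩ }
  refine hsAdjoint_petzDual_of_mem hT hρ hu hu' (W := W)
    (le_span_eigenIn_of_unitary hρ hu W ?_) ?_ hd
  · intro s x hx t
    have := hx (t + s)
    rw [Complex.ofReal_add, mul_add, neg_add_rev, ← pow_mul_pow hρ hu, ← pow_mul_pow hρ hu] at this
    simpa only [mul_assoc] using this
  · intro x hx
    have := hx 0
    simpa [pow_zero' hρ] using this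

end Reversibility

end QRev

end

theorem theorem3 {H : Type*} [NormedAddCommGroup H] [InnerProductSpace ℂ H] [CompleteSpace H]
    [FiniteDimensional ℂ H]
    {K : Type*} [NormedAddCommGroup K] [InnerProductSpace ℂ K] [CompleteSpace K]
    [FiniteDimensional ℂ K]
    (A : StarSubalgebra ℂ (H →L[ℂ] H)) (B : StarSubalgebra ℂ (K →L[ℂ] K))
    (T : A →ₗ[ℂ] B) (𝒮 : Set A) (h𝒮 : 𝒮 ⊆ QRev.densities A)
    (ρ : A) (hρ : ρ ∈ 𝒮) (hρ_inv : IsUnit ρ) (hTρ_inv : IsUnit (T ρ))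
    (hT : QRev.IsUnitalSchwarz (QRev.hsAdjoint T))
    (hTρ : QRev.IsUnitalSchwarz (QRev.petzDual T ρ)) :
    List.TFAE [
      QRev.Reversible T 𝒮,
      ∀ σ ∈ 𝒮, QRev.hsAdjoint T (QRev.rnDer (T σ) (T ρ)) = QRev.rnDer σ ρ,
      ∀ σ ∈ 𝒮, QRev.rnDer σ ρ ∈ QRev.fixedPts (QRev.hsAdjoint T ∘ₗ QRev.petzDual T ρ),
      ∀ σ ∈ 𝒮, ∀ t : ℝ,
        QRev.pow ρ (Complex.I * t) * QRev.rnDer σ ρ * QRev.pow ρ (-(Complex.I * t)) ∈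
          QRev.hsAdjoint T '' QRev.multDomain (QRev.hsAdjoint T),
      ∃ S : B →ₗ[ℂ] A, QRev.IsCPTP S ∧ ∀ σ ∈ 𝒮, S (T σ) = σ,
      ∃ (T' : A →ₗ[ℂ] B) (S : B →ₗ[ℂ] A), QRev.IsCPTP T' ∧ QRev.IsCPTP S ∧
        ∀ σ ∈ 𝒮, T' σ = T σ ∧ S (T σ) = σ] := by
  have hρ0 := (h𝒮 hρ).1
  have hpair := QRev.isInvariantPair_petzDual hT hρ0 hρ_inv hTρ_inv hTρ
  tfae_have 1 → 4 := by
    rintro ⟨S, hS, hST⟩ σ hσ t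
    exact QRev.modular_orbit_mem_of_recovery hT hρ0 hρ_inv hTρ_inv hS (hST ρ hρ) (hST σ hσ) _
  tfae_have 4 → 3 := fun h σ hσ =>
    QRev.mem_fixedPts_of_modular_orbit hT hρ0 hρ_inv hTρ_inv (h σ hσ)
  tfae_have 2 ↔ 3 := by
    refine forall₂_congr fun σ _ => ?_
    rw [← QRev.petzDual_rnDer T σ hρ0 hρ_inv]
    rfl
  tfae_have 3 → 6 := by
    intro h
    obtain ⟨S, hS, hSb⟩ := hpair.exists_isCPTP
    obtain ⟨T', hT', hTa⟩ := hpair.symm.exists_isCPTP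
    refine ⟨T', S, hT', hS, fun σ hσ => ⟨?_, ?_⟩⟩
    -- `T_ρ` carries fixed points of `T* ∘ T_ρ` to fixed points of `T_ρ ∘ T*`, so the swapped pair
    -- yields the forward channel.
    · have hd : QRev.rnDer (T σ) (T ρ) ∈
          QRev.fixedPts (QRev.petzDual T ρ ∘ₗ QRev.hsAdjoint T) := by
        rw [← QRev.petzDual_rnDer T σ hρ0 hρ_inv]
        exact congrArg (QRev.petzDual T ρ) (h σ hσ)
      have := hTa _ hd σ
      rw [QRev.pow_half_mul_rnDer_mul_pow_half _ hpair.nonneg' hTρ_inv] at this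
      exact this fun n _ => QRev.hsAdjoint_spec T n σ
    · have := hSb _ (h σ hσ) (T σ)
      rw [QRev.pow_half_mul_rnDer_mul_pow_half _ hρ0 hρ_inv] at this
      refine this fun n hn => ?_
      rw [← QRev.hsAdjoint_spec]
      exact congrArg (fun x => QRev.tr A (star x * σ)) hn
  tfae_have 6 → 5 := fun ⟨_, S, _, hS, h⟩ => ⟨S, hS, fun σ hσ => (h σ hσ).2⟩
  tfae_have 5 → 1 := fun ⟨S, hS, h⟩ => ⟨S, hS.isUnitalSchwarz, h⟩
  tfae_finish
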